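/- Work in the polar-coordinate model of the hyperbolic plane $\mathbb{H}^2$ with pole $O$: a point $P$ has a radius $r(P)\ge 0$ and an angle $\varphi(P)$, and $\cosh|PQ|=\cosh r(P)\cosh r(Q)-\sinh r(P)\sinh r(Q)\cos(\varphi(P)-\varphi(Q))$. Let $\mathcal S\subset\mathbb{H}^2$ be a finite set of sites and, for a sweep radius $\hat r$, let $\mathcal S_{\le \hat r}=\{S\in\mathcal S : r(S)\le\hat r\}$. The beach ellipse of a site $S\in\mathcal S_{\le\hat r}$ is $E_S=\{P : r(P)\le\hat r,\ |PS|=\hat r-r(P)\}$. Its active part $A(E_S)$ consists of those $P\in E_S$ for which there are no $S'\in\mathcal S_{\le\hat r}$ and $P'\in E_{S'}$ with $\varphi(P')=\varphi(P)$ and $r(P')>r(P)$. The beach curve is $\mathcal B=\bigcup_{S\in\mathcal S_{\le\hat r}}A(E_S)$. An active segment of $S$ at sweep radius $\hat r$ is a connected component of $A(E_S)$ with more than one point. For $r_1<r_2$, an active segment $C$ of $S$ at $\hat r=r_2$ continues an active segment $C'$ of $S$ at $\hat r=r_1$ if there is a continuous path $\gamma$ on $[r_1,r_2]$ with $\gamma(r_1)\in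 C'$ and $\gamma(r_2)\in C$ such that, for every $\hat r\in[r_1,r_2]$, $\gamma(\hat r)$ lies on an active segment of $S$ at sweep radius $\hat r$. A segment $C$ of $S$ at $r_2$ became active since $r_1$ if there is no active segment $C'$ of $S$ at $r_1$ such that $C$ is the one and only active segment of $S$ at $r_2$ that continues $C'$. A site event occurs when $\hat r=r(T)$ for some $T\in\mathcal S$. Then the following hold. (1) New segments become active only through site events: if $r_1<r_2$ and an active segment of a site $S$ at $r_2$ became active since $r_1$, then $r(T)\in[r_1,r_2]$ for some $T\in\mathcal S$. (2) If moreover the segment continues no active segment of $S$ at $r_1$ at all, then $r(S)\in[r_1,r_2]$, so that the site event of $S$ itself occurs. (3) Call $V$ a Voronoi vertex if it is the center of a circle with at least three sites on it and no site strictly inside, and let its far point $V'$ be a point of largest radius on this circle. Let $\bar{\mathcal Q}$ consist of $0$, $\infty$, the radii $r(S)$ of all sites (site events) and the radii $r(V')$ for all Voronoi vertices $V$ (true circle events), and let $r_i<r_j$ be consecutive in $\bar{\mathcal Q}$. Then for no $r\in(r_i,r_j)$ does a beach-ellipse intersection of two distinct sites $S,T\in\mathcal S$ enter the beach curve at $r$.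 That is, there are no $\varepsilon>0$ and no point $I(\hat r)\in E_S\cap E_T$ moving continuously with $\hat r\in[r-\varepsilon,r]$ such that $I(\hat r)\notin\mathcal B$ for all $\hat r\in[r-\varepsilon,r)$ and $I(r)\in\mathcal B$ at $\hat r=r$. -/

import Mathlib

noncomputable section

namespace HyperbolicSweep

/-- Hyperbolic distance in the polar-coordinate model of the hyperbolic plane. The point with
radius `r` and angle `φ` is represented by the complex number `r * exp (i φ)`; the pole is `0`,
the radius of `A` is `‖A‖` and its angle is `A.arg`. -/
def hypDist (A B : ℂ) : ℝ :=
  Real.arcosh (Real.cosh ‖A‖ * Real.cosh ‖B‖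
    - Real.sinh ‖A‖ * Real.sinh ‖B‖ * Real.cos (A.arg - B.arg))

/-- The hyperbolic circle with center `V` and radius `d`. -/
def hypCircle (V : ℂ) (d : ℝ) : Set ℂ := {Q | hypDist V Q = d}

/-- The sites contained in the sweep circle of radius `ρ` around the pole. -/
def seenSites (𝒮 : Finset ℂ) (ρ : ℝ) : Set ℂ := {S | S ∈ 𝒮 ∧ ‖S‖ ≤ ρ}

/-- The beach ellipse of `S` for the sweep radius `ρ`: the points equidistant from `S` and from
the sweep circle. A point `P` inside the sweep circle has distance `ρ - ‖P‖` to it. -/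
def beachEllipse (S : ℂ) (ρ : ℝ) : Set ℂ := {P | ‖P‖ ≤ ρ ∧ hypDist P S = ρ - ‖P‖}

/-- The active part of the beach ellipse of the site `S`: no point at the same angle on the
beach ellipse of a seen site is farther from the pole. -/
def activePart (𝒮 : Finset ℂ) (S : ℂ) (ρ : ℝ) : Set ℂ :=
  {P | P ∈ beachEllipse S ρ ∧
    ¬ ∃ S' ∈ seenSites 𝒮 ρ, ∃ P' ∈ beachEllipse S' ρ, P.arg = P'.arg ∧ ‖P‖ < ‖P'‖}

/-- The beach curve for the sweep radius `ρ`. -/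
def beachCurve (𝒮 : Finset ℂ) (ρ : ℝ) : Set ℂ := ⋃ S ∈ seenSites 𝒮 ρ, activePart 𝒮 S ρ

/-- `V` is a Voronoi vertex with witness circle of radius `d`: no site is closer to `V` than `d`,
and at least three sites are at distance `d`. -/
def IsVoronoiVertex (𝒮 : Finset ℂ) (V : ℂ) (d : ℝ) : Prop :=
  (∀ S ∈ 𝒮, d ≤ hypDist V S) ∧ 3 ≤ {S : ℂ | S ∈ 𝒮 ∧ hypDist V S = d}.ncard

/-- `V'` is a point of maximal radius on the circle with center `V` and radius `d`. -/
def IsFarPoint (V : ℂ) (d : ℝ) (V' : ℂ) : Prop :=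
  V' ∈ hypCircle V d ∧ ∀ Q ∈ hypCircle V d, ‖Q‖ ≤ ‖V'‖

/-- The radii of the site events and of the true circle events, together with `0` and `∞`. -/
def eventRadii (𝒮 : Finset ℂ) : Set EReal :=
  {0, ⊤} ∪ {q | ∃ S ∈ 𝒮, q = ((‖S‖ : ℝ) : EReal)} ∪
    {q | ∃ V d V', IsVoronoiVertex 𝒮 V d ∧ IsFarPoint V d V' ∧ q = ((‖V'‖ : ℝ) : EReal)}

/-- Some intersection of the beach ellipses of `S` and `T`, regarded as a point that moves
continuously with the sweep radius, enters the beach curve at the sweep radius `r`. -/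
def IntersectionEntersAt (𝒮 : Finset ℂ) (S T : ℂ) (r : ℝ) : Prop :=
  ∃ ε > 0, ∃ I : ℝ → ℂ, ContinuousOn I (Set.Icc (r - ε) r) ∧
    (∀ ρ ∈ Set.Icc (r - ε) r, I ρ ∈ beachEllipse S ρ ∩ beachEllipse T ρ) ∧
    (∀ ρ ∈ Set.Ico (r - ε) r, I ρ ∉ beachCurve 𝒮 ρ) ∧ I r ∈ beachCurve 𝒮 r

/-- The active beach ellipse segments of `S`: the maximal connected pieces of the active part.
A piece that has shrunk to a single point counts as vanished. -/
def activeSegments (𝒮 : Finset ℂ) (S : ℂ) (ρ : ℝ) : Set (Set ℂ) :=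
  {C | C.Nontrivial ∧ ∃ P ∈ activePart 𝒮 S ρ, C = connectedComponentIn (activePart 𝒮 S ρ) P}

/-- The segment `C` of `S` at sweep radius `r₂` continues the segment `C'` of `S` at sweep radius
`r₁`: while the sweep radius grows from `r₁` to `r₂`, a point can move continuously from `C'`
to `C` and stay on active segments of `S` all the time. -/
def Continues (𝒮 : Finset ℂ) (S : ℂ) (r₁ : ℝ) (C' : Set ℂ) (r₂ : ℝ) (C : Set ℂ) : Prop :=
  ∃ γ : ℝ → ℂ, ContinuousOn γ (Set.Icc r₁ r₂) ∧
    (∀ ρ ∈ Set.Icc r₁ r₂, ∃ D ∈ activeSegments 𝒮 S ρ, γ ρ ∈ D) ∧ γ r₁ ∈ C' ∧ γ r₂ ∈ C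

/-- The active segment `C` of `S` at sweep radius `r₂` has become active since the sweep radius
was `r₁`: it is not the unique continuation of a segment of `S` that was active at `r₁`. So it
either continues no earlier segment, or is one of several parts of an earlier segment. -/
def BecameActive (𝒮 : Finset ℂ) (S : ℂ) (r₁ r₂ : ℝ) (C : Set ℂ) : Prop :=
  C ∈ activeSegments 𝒮 S r₂ ∧
    ¬ ∃ C' ∈ activeSegments 𝒮 S r₁, Continues 𝒮 S r₁ C' r₂ C ∧
      ∀ D ∈ activeSegments 𝒮 S r₂, Continues 𝒮 S r₁ C' r₂ D → D = C

end HyperbolicSweep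

end

open HyperbolicSweep

/-! On the hyperboloid, the hyperbolic cosine of the distance is bilinear in the two points. The
beach ellipse of a site `S` with `‖S‖ < ρ` is then a graph over the unit circle of directions. Its
points that have `S` as a nearest site are the active ones, up to the degenerate ellipses of sites
on the sweep circle (`mem_activePart_of_closest`, `coshDist_le_of_mem_activePart`).

Claim (2) is the existence of a predecessor (`exists_continues`). A segment is infinite, while only
finitely many points of an ellipse are equidistant from `S` and a given other site, so some point of
the segment is strictly closest to `S`. In the Klein model bisectors are straight and the ellipses
bound convex sets. Pulled straight towards `S`, the point stays strictly closest and crosses the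
ellipse of every smaller radius exactly once, at a place that varies continuously
(`StrictlyClosest.exists_path`). All this needs is `‖S‖ < r₁`.

Claim (1) also needs that no segment splits without a site event (`Continues.unique`). On the
ellipse of `S`, the comparison of `S` with `T` has the sign of an affine function of the direction
(`bisectorForm`), so `T` cuts out at most one arc. That arc always contains the direction `barrier S
T`, which does not depend on `ρ`. The directions used by two continuations and their common ancestor
form a connected set that avoids every barrier. If both arcs between the two final directions were
interrupted, there would be a barrier on each arc and this set could not be connected
(`exists_isPreconnected_nonpos`).

For claim (3), an intersection on the beach curve has `S` and `T` as nearest sites. If a third site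
is equally near, the intersection is a Voronoi vertex whose far point has radius `r`, so `r` is an
event. Otherwise all other sites are strictly farther, by continuity also slightly before `r`, and
the intersection was on the beach curve already. -/

noncomputable section

namespace HyperbolicSweep

open Real Set

/-! ### Directions and the hyperboloid model -/

/-- The Euclidean inner product of two complex numbers. -/
def dot (z w : ℂ) : ℝ := z.re * w.re + z.im * w.im

/-- The direction of a complex number, as a number of norm `1` (and `0` for the pole). -/
def dir (z : ℂ) : ℂ := z / ‖z‖

/-- The spatial part of the point of the hyperboloid model with polar coordinates given by `A`. -/
def sinhVec (A : ℂ) : ℂ := (sinh ‖A‖ : ℂ) * dir A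

/-- The hyperbolic cosine of the hyperbolic distance. -/
def coshDist (A B : ℂ) : ℝ := cosh ‖A‖ * cosh ‖B‖ - dot (sinhVec A) (sinhVec B)

theorem dot_comm (z w : ℂ) : dot z w = dot w z := by simp only [dot]; ring

theorem dot_add (z w v : ℂ) : dot z (w + v) = dot z w + dot z v := by
  simp only [dot, Complex.add_re, Complex.add_im]; ring

theorem dot_sub (z w v : ℂ) : dot z (w - v) = dot z w - dot z v := by
  simp only [dot, Complex.sub_re, Complex.sub_im]; ring

theorem dot_ofReal_mul (a : ℝ) (z w : ℂ) : dot (a * z) w = a * dot z w := by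
  simp only [dot, Complex.re_ofReal_mul, Complex.im_ofReal_mul]; ring

theorem dot_mul_ofReal (a : ℝ) (z w : ℂ) : dot z (a * w) = a * dot z w := by
  simp only [dot, Complex.re_ofReal_mul, Complex.im_ofReal_mul]; ring

theorem dot_neg_left (z w : ℂ) : dot (-z) w = - dot z w := by
  simp only [dot, Complex.neg_re, Complex.neg_im]; ring

theorem dot_self (z : ℂ) : dot z z = ‖z‖ ^ 2 := by
  rw [← Complex.normSq_eq_norm_sq, Complex.normSq_apply, dot]

theorem dot_le (z w : ℂ) : dot z w ≤ ‖z‖ * ‖w‖ := by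
  apply le_of_sq_le_sq _ (by positivity)
  rw [mul_pow, ← dot_self, ← dot_self]
  simp only [dot]
  nlinarith [sq_nonneg (z.re * w.im - z.im * w.re)]

theorem continuous_dot_left (w : ℂ) : Continuous fun z => dot z w := by
  unfold dot; fun_prop

theorem norm_dir {z : ℂ} (hz : z ≠ 0) : ‖dir z‖ = 1 := by
  have : ‖z‖ ≠ 0 := by simpa
  simp [dir, this]

theorem norm_mul_dir (z : ℂ) : (‖z‖ : ℂ) * dir z = z := by
  rcases eq_or_ne z 0 with rfl | hz
  · simp
  · have : (‖z‖ : ℂ) ≠ 0 := by simpa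
    simp only [dir]; field_simp

theorem dir_ofReal_mul {p : ℝ} (hp : 0 < p) {e : ℂ} (he : ‖e‖ = 1) : dir (p * e) = e := by
  have : (p : ℂ) ≠ 0 := by exact_mod_cast hp.ne'
  simp only [dir, norm_mul, he, Complex.norm_real, norm_of_nonneg hp.le, mul_one]
  field_simp

theorem norm_ofReal_mul {p : ℝ} (hp : 0 ≤ p) {e : ℂ} (he : ‖e‖ = 1) : ‖(p : ℂ) * e‖ = p := by
  simp [he, abs_of_nonneg hp]

theorem dir_eq_of_arg_eq {z w : ℂ} (hz : z ≠ 0) (hw : w ≠ 0) (h : z.arg = w.arg) :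
    dir z = dir w := by
  have := (Complex.arg_eq_arg_iff hz hw).1 h
  have h1 : (‖z‖ : ℂ) ≠ 0 := by simpa
  have h2 : (‖w‖ : ℂ) ≠ 0 := by simpa
  rw [dir, dir, div_eq_div_iff h1 h2]
  field_simp at this
  linear_combination this

theorem arg_ofReal_mul_eq {p q : ℝ} (hp : 0 < p) (hq : 0 < q) (e : ℂ) :
    Complex.arg (p * e) = Complex.arg (q * e) := by
  rw [Complex.arg_real_mul _ hp, Complex.arg_real_mul _ hq]

theorem continuousAt_dir {z : ℂ} (hz : z ≠ 0) : ContinuousAt dir z := by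
  unfold dir
  have : (‖z‖ : ℂ) ≠ 0 := by simpa
  fun_prop (disch := assumption)

theorem sinhVec_ofReal_mul {p : ℝ} (hp : 0 ≤ p) {e : ℂ} (he : ‖e‖ = 1) :
    sinhVec (p * e) = (sinh p : ℂ) * e := by
  rcases hp.eq_or_lt with rfl | hp
  · simp [sinhVec]
  · rw [sinhVec, norm_ofReal_mul hp.le he, dir_ofReal_mul hp he]

theorem norm_sinhVec (A : ℂ) : ‖sinhVec A‖ = sinh ‖A‖ := by
  rcases eq_or_ne A 0 with rfl | h
  · simp [sinhVec]
  · have := sinh_nonneg_iff.2 (norm_nonneg A)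
    rw [sinhVec, norm_mul, norm_dir h, mul_one, Complex.norm_real,
      norm_of_nonneg this]

theorem dot_sinhVec_le (A : ℂ) {e : ℂ} (he : ‖e‖ = 1) : dot e (sinhVec A) ≤ sinh ‖A‖ := by
  simpa [he, norm_sinhVec] using dot_le e (sinhVec A)

theorem continuousAt_sinhVec {z : ℂ} (hz : z ≠ 0) : ContinuousAt sinhVec z := by
  unfold sinhVec
  have := continuousAt_dir hz
  fun_prop

theorem continuousAt_coshDist {z : ℂ} (hz : z ≠ 0) (A : ℂ) :
    ContinuousAt (fun z => coshDist z A) z := by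
  unfold coshDist
  have := (continuous_dot_left (sinhVec A)).continuousAt.comp (continuousAt_sinhVec hz)
  refine ContinuousAt.sub (by fun_prop) this

theorem coshDist_eq (A B : ℂ) : cosh ‖A‖ * cosh ‖B‖ - sinh ‖A‖ * sinh ‖B‖ * cos (A.arg - B.arg)
    = coshDist A B := by
  have h1 : ∀ C : ℂ, sinhVec C = (sinh ‖C‖ : ℂ) * (cos C.arg + sin C.arg * Complex.I) := by
    intro C
    rcases eq_or_ne C 0 with rfl | h
    · simp [sinhVec]
    · have h3 : (‖C‖ : ℂ) ≠ 0 := by simpa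
      have := Complex.norm_mul_cos_add_sin_mul_I C
      rw [sinhVec, dir]
      congr 1
      rw [div_eq_iff h3]
      push_cast
      rw [mul_comm, this]
  rw [coshDist, h1, h1, dot_ofReal_mul,
    dot_mul_ofReal, cos_sub]
  simp [dot, -Complex.ofReal_cos, -Complex.ofReal_sin]
  ring

/-- Cauchy–Schwarz for the spatial parts; this is the triangle inequality with the pole as third
point. -/
theorem cosh_norm_sub_le_coshDist (A B : ℂ) : cosh (‖A‖ - ‖B‖) ≤ coshDist A B := by
  have := dot_le (sinhVec A) (sinhVec B)
  rw [norm_sinhVec, norm_sinhVec] at this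
  rw [cosh_sub, coshDist]; linarith

theorem one_le_coshDist (A B : ℂ) : 1 ≤ coshDist A B :=
  (one_le_cosh _).trans (cosh_norm_sub_le_coshDist A B)

theorem hypDist_eq_iff {A B : ℂ} {d : ℝ} (hd : 0 ≤ d) :
    hypDist A B = d ↔ coshDist A B = cosh d := by
  rw [hypDist, coshDist_eq]
  constructor
  · rintro rfl; rw [cosh_arcosh (one_le_coshDist A B)]
  · intro h; rw [h, arcosh_cosh hd]

theorem le_hypDist_iff {A B : ℂ} {d : ℝ} (hd : 0 ≤ d) :
    d ≤ hypDist A B ↔ cosh d ≤ coshDist A B := by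
  rw [hypDist, coshDist_eq, ← arcosh_le_arcosh (cosh_pos d) (by linarith [one_le_coshDist A B]),
    arcosh_cosh hd]

/-! ### Beach ellipses as graphs over the circle of directions -/

theorem mem_beachEllipse_iff {S P : ℂ} {ρ : ℝ} :
    P ∈ beachEllipse S ρ ↔ ‖P‖ ≤ ρ ∧ coshDist P S = cosh (ρ - ‖P‖) := by
  simp only [beachEllipse, mem_ofPred_eq]
  exact and_congr_right fun h => hypDist_eq_iff (by linarith)

theorem norm_le_of_mem_beachEllipse {S P : ℂ} {ρ : ℝ} (h : P ∈ beachEllipse S ρ) : ‖S‖ ≤ ρ := by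
  obtain ⟨h1, h2⟩ := mem_beachEllipse_iff.1 h
  have := cosh_norm_sub_le_coshDist P S
  rw [h2, cosh_le_cosh, abs_of_nonneg (by linarith : 0 ≤ ρ - ‖P‖)] at this
  have := neg_abs_le (‖P‖ - ‖S‖)
  linarith

/-- For `P` in direction `e` at radius `p`, the sign of this quantity tells on which side of the
beach ellipse of `S` the point `P` lies. -/
def ellipseGap (S : ℂ) (ρ : ℝ) (e : ℂ) (p : ℝ) : ℝ :=
  sinh p * (sinh ρ - dot e (sinhVec S)) - cosh p * (cosh ρ - cosh ‖S‖)

theorem coshDist_ofReal_mul (S : ℂ) {e : ℂ} (he : ‖e‖ = 1) {p : ℝ} (hp : 0 ≤ p) :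
    coshDist (p * e) S = cosh p * cosh ‖S‖ - sinh p * dot e (sinhVec S) := by
  rw [coshDist, sinhVec_ofReal_mul hp he, norm_ofReal_mul hp he, dot_ofReal_mul]

theorem coshDist_eq_add_ellipseGap (S : ℂ) (ρ : ℝ) {e : ℂ} (he : ‖e‖ = 1) {p : ℝ} (hp : 0 ≤ p) :
    coshDist (p * e) S = cosh (ρ - p) + ellipseGap S ρ e p := by
  rw [coshDist_ofReal_mul S he hp, ellipseGap, cosh_sub]; ring

theorem cosh_sub_cosh_pos {s ρ : ℝ} (h0 : 0 ≤ s) (h : s < ρ) : 0 < cosh ρ - cosh s := by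
  rw [sub_pos, cosh_lt_cosh, abs_of_nonneg h0, abs_of_nonneg (by linarith)]; exact h

theorem ne_zero_of_mem_beachEllipse {S P : ℂ} {ρ : ℝ} (hS : ‖S‖ < ρ) (h : P ∈ beachEllipse S ρ) :
    P ≠ 0 := by
  rintro rfl
  obtain ⟨h1, h2⟩ := mem_beachEllipse_iff.1 h
  have : coshDist 0 S = cosh ‖S‖ := by simp [coshDist, sinhVec, dot]
  rw [this, norm_zero, sub_zero] at h2
  linarith [cosh_sub_cosh_pos (norm_nonneg S) hS]

/-- Inside the beach ellipse the gap is negative: it is increasing along each ray. -/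
theorem ellipseGap_nonpos_of_lt {S e : ℂ} {ρ p q : ℝ} (hS : ‖S‖ ≤ ρ) (hp : 0 ≤ p) (hpq : p < q)
    (hq : ellipseGap S ρ e q = 0) :
    ellipseGap S ρ e p ≤ 0 ∧ (‖S‖ < ρ → ellipseGap S ρ e p < 0) := by
  -- The gap is a linear combination of `sinh` and `cosh`; eliminating its `sinh` coefficient
  -- between `p` and `q` leaves a multiple of `sinh (q - p)`.
  have h1 : ellipseGap S ρ e p * sinh q = -((cosh ρ - cosh ‖S‖) * sinh (q - p)) := by
    have : ellipseGap S ρ e p * sinh q =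
      ellipseGap S ρ e q * sinh p - (cosh ρ - cosh ‖S‖) * sinh (q - p) := by
      rw [sinh_sub]; simp only [ellipseGap]; ring
    rw [this, hq]; ring
  have h2 : 0 < sinh q := sinh_pos_iff.2 (by linarith)
  have h3 : 0 < sinh (q - p) := sinh_pos_iff.2 (by linarith)
  have h0 := norm_nonneg S
  constructor
  · have h4 : 0 ≤ cosh ρ - cosh ‖S‖ := by
      rw [sub_nonneg, cosh_le_cosh, abs_of_nonneg h0, abs_of_nonneg (by linarith)]; exact hS
    have := mul_nonneg h4 h3.le
    by_contra! h
    nlinarith [mul_pos h h2]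
  · intro hS
    have h4 := cosh_sub_cosh_pos h0 hS
    have := mul_pos h4 h3
    by_contra! h
    nlinarith [mul_nonneg h h2.le]

theorem sinh_sub_dot_pos {S e : ℂ} {ρ : ℝ} (hS : ‖S‖ < ρ) (he : ‖e‖ = 1) :
    0 < sinh ρ - dot e (sinhVec S) := by
  linarith [dot_sinhVec_le S he, sinh_lt_sinh.2 hS]

/-- The radius of the point of the beach ellipse of `S` in direction `e`. -/
def ellipseRadius (S : ℂ) (ρ : ℝ) (e : ℂ) : ℝ :=
  artanh ((cosh ρ - cosh ‖S‖) / (sinh ρ - dot e (sinhVec S)))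

/-- The point of the beach ellipse of `S` in direction `e`. -/
def ellipsePoint (S : ℂ) (ρ : ℝ) (e : ℂ) : ℂ := ellipseRadius S ρ e * e

/-- The quotient is the value of `tanh p` at which the gap vanishes. The upper bound reduces to `1 <
cosh (ρ - ‖S‖)` in the worst direction, that of `S`. -/
theorem div_mem_Ioo {S e : ℂ} {ρ : ℝ} (hS : ‖S‖ < ρ) (he : ‖e‖ = 1) :
    (cosh ρ - cosh ‖S‖) / (sinh ρ - dot e (sinhVec S)) ∈ Ioo 0 (tanh ρ) := by
  have hb := cosh_sub_cosh_pos (norm_nonneg S) hS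
  have ha := sinh_sub_dot_pos hS he
  refine ⟨div_pos hb ha, ?_⟩
  rw [tanh_eq_sinh_div_cosh, div_lt_div_iff₀ ha (cosh_pos ρ)]
  have h1 : 1 < cosh (ρ - ‖S‖) := one_lt_cosh.2 (by linarith)
  have h2 := dot_sinhVec_le S he
  have h3 : 0 < sinh ρ := sinh_pos_iff.2 (by linarith [norm_nonneg S])
  have h4 := cosh_sq ρ
  rw [cosh_sub] at h1
  nlinarith

theorem tanh_ellipseRadius {S e : ℂ} {ρ : ℝ} (hS : ‖S‖ < ρ) (he : ‖e‖ = 1) :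
    tanh (ellipseRadius S ρ e) = (cosh ρ - cosh ‖S‖) / (sinh ρ - dot e (sinhVec S)) := by
  have h := div_mem_Ioo hS he
  exact tanh_artanh ⟨by linarith [h.1], by linarith [h.2, tanh_lt_one ρ]⟩

theorem ellipseRadius_mem {S e : ℂ} {ρ : ℝ} (hS : ‖S‖ < ρ) (he : ‖e‖ = 1) :
    ellipseRadius S ρ e ∈ Ioo 0 ρ := by
  have h := div_mem_Ioo hS he
  have h2 := tanh_lt_one ρ
  refine ⟨artanh_pos ⟨h.1, by linarith [h.2]⟩, ?_⟩
  calc _ < artanh (tanh ρ) := artanh_lt_artanh (by linarith [h.1]) h2 h.2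
    _ = ρ := artanh_tanh ρ

theorem ellipseGap_eq_zero_iff {S e : ℂ} {ρ p : ℝ} (hS : ‖S‖ < ρ) (he : ‖e‖ = 1) :
    ellipseGap S ρ e p = 0 ↔ p = ellipseRadius S ρ e := by
  have ha := sinh_sub_dot_pos hS he
  have hp := cosh_pos p
  have h1 : ellipseGap S ρ e p = 0 ↔ tanh p = tanh (ellipseRadius S ρ e) := by
    rw [tanh_ellipseRadius hS he, tanh_eq_sinh_div_cosh, div_eq_div_iff hp.ne' ha.ne', ellipseGap,
      sub_eq_zero, mul_comm (cosh p)]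
  rw [h1]
  exact ⟨fun h => by rw [← artanh_tanh p, h, artanh_tanh], fun h => by rw [h]⟩

theorem ellipsePoint_mem {S e : ℂ} {ρ : ℝ} (hS : ‖S‖ < ρ) (he : ‖e‖ = 1) :
    ellipsePoint S ρ e ∈ beachEllipse S ρ := by
  have h := ellipseRadius_mem hS he
  rw [mem_beachEllipse_iff, ellipsePoint, norm_ofReal_mul h.1.le he,
    coshDist_eq_add_ellipseGap S ρ he h.1.le, (ellipseGap_eq_zero_iff hS he).2 rfl]
  exact ⟨h.2.le, by simp⟩

theorem mem_beachEllipse_iff_gap {S e : ℂ} {ρ p : ℝ} (he : ‖e‖ = 1) (hp : 0 ≤ p) :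
    (p : ℂ) * e ∈ beachEllipse S ρ ↔ p ≤ ρ ∧ ellipseGap S ρ e p = 0 := by
  rw [mem_beachEllipse_iff, norm_ofReal_mul hp he, coshDist_eq_add_ellipseGap S ρ he hp,
    add_eq_left]

theorem eq_ellipsePoint {S P : ℂ} {ρ : ℝ} (hS : ‖S‖ < ρ) (h : P ∈ beachEllipse S ρ) :
    P = ellipsePoint S ρ (dir P) := by
  have h0 := norm_dir (ne_zero_of_mem_beachEllipse hS h)
  rw [← norm_mul_dir P, mem_beachEllipse_iff_gap h0 (norm_nonneg P),
    ellipseGap_eq_zero_iff hS h0] at h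
  rw [ellipsePoint, ← h.2, norm_mul_dir]

theorem dir_ellipsePoint {S e : ℂ} {ρ : ℝ} (hS : ‖S‖ < ρ) (he : ‖e‖ = 1) :
    dir (ellipsePoint S ρ e) = e :=
  dir_ofReal_mul (ellipseRadius_mem hS he).1 he

theorem continuousAt_ellipsePoint {S e : ℂ} {ρ : ℝ} (hS : ‖S‖ < ρ) (he : ‖e‖ = 1) :
    ContinuousAt (fun x : ℝ × ℂ => ellipsePoint S x.1 x.2) (ρ, e) := by
  have h := div_mem_Ioo hS he
  have h2 := tanh_lt_one ρ
  have ha := sinh_sub_dot_pos hS he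
  have h1 : ContinuousAt (fun x : ℝ × ℂ =>
      (cosh x.1 - cosh ‖S‖) / (sinh x.1 - dot x.2 (sinhVec S))) (ρ, e) := by
    unfold dot
    refine ContinuousAt.div (by fun_prop) (by fun_prop) ?_
    exact ha.ne'
  have h3 : ContinuousAt artanh ((cosh ρ - cosh ‖S‖) / (sinh ρ - dot e (sinhVec S))) := by
    unfold artanh
    have : (1 - (cosh ρ - cosh ‖S‖) / (sinh ρ - dot e (sinhVec S))) ≠ 0 := by linarith [h.2]
    refine ContinuousAt.log
      (ContinuousAt.sqrt (ContinuousAt.div (by fun_prop) (by fun_prop) this)) ?_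
    exact (sqrt_pos.2 (div_pos (by linarith [h.1]) (by linarith [h.2]))).ne'
  have h4 : ContinuousAt (fun x : ℝ × ℂ => ellipseRadius S x.1 x.2) (ρ, e) :=
    ContinuousAt.comp (f := fun x : ℝ × ℂ =>
      (cosh x.1 - cosh ‖S‖) / (sinh x.1 - dot x.2 (sinhVec S))) (g := artanh) h3 h1
  unfold ellipsePoint
  exact (Complex.continuous_ofReal.continuousAt.comp h4).mul continuousAt_snd

/-! ### Active points and nearest sites -/

/-- If the ellipse of `T` had a point farther out on the ray of `P`, the gap of `T` at `P` would be
negative, so `T` would be nearer than `S`. For `‖T‖ = ρ` the ellipse degenerates and the gap may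
vanish, hence the strict alternative. -/
theorem mem_activePart_of_closest {𝒮 : Finset ℂ} {S P : ℂ} {ρ : ℝ} (hS : ‖S‖ < ρ)
    (hP : P ∈ beachEllipse S ρ)
    (h : ∀ T ∈ 𝒮, coshDist P S < coshDist P T ∨ (coshDist P S ≤ coshDist P T ∧ ‖T‖ < ρ)) :
    P ∈ activePart 𝒮 S ρ := by
  refine ⟨hP, ?_⟩
  rintro ⟨T, ⟨hT, hTρ⟩, P', hP', harg, hlt⟩
  have hP0 := ne_zero_of_mem_beachEllipse hS hP
  have hP0' : P' ≠ 0 := by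
    rintro rfl
    linarith [norm_nonneg P, norm_zero (E := ℂ)]
  have he := norm_dir hP0
  have hgap : ellipseGap T ρ (dir P) ‖P'‖ = 0 := by
    rw [dir_eq_of_arg_eq hP0 hP0' harg]
    rw [← norm_mul_dir P', mem_beachEllipse_iff_gap (norm_dir hP0') (norm_nonneg _)] at hP'
    exact hP'.2
  have hneg := ellipseGap_nonpos_of_lt hTρ (norm_nonneg P) hlt hgap
  have h1 := coshDist_eq_add_ellipseGap T ρ he (norm_nonneg P)
  rw [norm_mul_dir, ← (mem_beachEllipse_iff.1 hP).2] at h1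
  rcases h T hT with h2 | ⟨h2, h3⟩
  · linarith [hneg.1]
  · linarith [hneg.2 h3]

/-- The triangle inequality bounds the distance to `T` below by `‖T‖ - ‖P‖`, which is at least `ρ -
‖P‖`. Equality would put `T` on the sweep circle and on the ray of `P`; then `T`, a point of its own
ellipse, would be farther out than `P`, which would not be active. -/
theorem coshDist_lt_of_mem_activePart {𝒮 : Finset ℂ} {S T P : ℂ} {ρ : ℝ} (hS : ‖S‖ < ρ)
    (hP : P ∈ activePart 𝒮 S ρ) (hT : T ∈ 𝒮) (hTρ : ρ ≤ ‖T‖) :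
    coshDist P S < coshDist P T := by
  obtain ⟨hPS, hact⟩ := hP
  obtain ⟨h1, h2⟩ := mem_beachEllipse_iff.1 hPS
  have hP0 := ne_zero_of_mem_beachEllipse hS hPS
  have he := norm_dir hP0
  have hpS : ‖P‖ < ρ := by
    refine h1.lt_of_ne fun h => ?_
    have h3 := cosh_norm_sub_le_coshDist P S
    have h4 : 1 < cosh (‖P‖ - ‖S‖) := one_lt_cosh.2 (by linarith)
    rw [h2, h, sub_self, cosh_zero, ← h] at h3
    linarith
  have h3 := cosh_norm_sub_le_coshDist P T
  rw [h2]
  rcases hTρ.eq_or_lt with rfl | hTρ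
  · rw [← cosh_neg, neg_sub] at h3
    refine h3.lt_of_ne fun h => hact ⟨T, ⟨hT, le_rfl⟩, T, ?_, ?_, hpS⟩
    · rw [mem_beachEllipse_iff]
      refine ⟨le_rfl, ?_⟩
      rw [coshDist, dot_self, norm_sinhVec, sub_self, cosh_zero]
      linarith [cosh_sq ‖T‖]
    · have hs : 0 < sinh ‖P‖ := sinh_pos_iff.2 (norm_pos_iff.2 hP0)
      have ht : 0 < sinh ‖T‖ := sinh_pos_iff.2 (lt_of_le_of_lt (norm_nonneg S) hS)
      have hT0 : T ≠ 0 := by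
        rintro rfl
        simp at ht
      have h5 : dot (dir P) (dir T) = 1 := by
        have h6 : coshDist P T = cosh ‖P‖ * cosh ‖T‖ -
            sinh ‖P‖ * (sinh ‖T‖ * dot (dir P) (dir T)) := by
          rw [coshDist, sinhVec, sinhVec, dot_ofReal_mul, dot_mul_ofReal]
        rw [h6, cosh_sub] at h
        have : sinh ‖P‖ * sinh ‖T‖ * (dot (dir P) (dir T) - 1) = 0 := by linarith
        have := (mul_eq_zero.1 this).resolve_left (by positivity)
        linarith
      have h7 : dir P = dir T := by
        have h8 : dot (dir P - dir T) (dir P - dir T) = 0 := by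
          have := dot_self (dir P)
          have h10 := dot_self (dir T)
          rw [he] at this
          rw [norm_dir hT0] at h10
          rw [dot_sub, dot_comm _ (dir P), dot_comm _ (dir T), dot_sub, dot_sub, dot_comm (dir T) (dir P)]
          linarith
        rw [dot_self] at h8
        exact sub_eq_zero.1 (norm_eq_zero.1 (pow_eq_zero_iff (by norm_num) |>.1 h8))
      rw [← norm_mul_dir P, ← norm_mul_dir T, h7]
      exact arg_ofReal_mul_eq (norm_pos_iff.2 hP0) (norm_pos_iff.2 hT0) _
  · refine lt_of_lt_of_le ?_ h3
    rw [cosh_lt_cosh, abs_of_nonneg (by linarith), abs_of_nonpos (by linarith)]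
    linarith

theorem lt_ellipseRadius_of_ellipseGap_neg {T e : ℂ} {ρ p : ℝ} (hT : ‖T‖ < ρ) (he : ‖e‖ = 1)
    (h : ellipseGap T ρ e p < 0) : p < ellipseRadius T ρ e := by
  have ha := sinh_sub_dot_pos hT he
  have h1 : tanh p < tanh (ellipseRadius T ρ e) := by
    rw [tanh_ellipseRadius hT he, tanh_eq_sinh_div_cosh, div_lt_div_iff₀ (cosh_pos p) ha]
    rw [ellipseGap] at h
    linarith
  have h2 := artanh_lt_artanh (neg_one_lt_tanh p) (tanh_lt_one _) h1
  rwa [artanh_tanh, artanh_tanh] at h2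

/-- A nearer site `T` makes its gap at `P` negative, so its ellipse passes beyond `P` on the same
ray. -/
theorem coshDist_le_of_mem_activePart_of_lt {𝒮 : Finset ℂ} {S T P : ℂ} {ρ : ℝ} (hS : ‖S‖ < ρ)
    (hP : P ∈ activePart 𝒮 S ρ) (hT : T ∈ 𝒮) (hTρ : ‖T‖ < ρ) :
    coshDist P S ≤ coshDist P T := by
  obtain ⟨hPS, hact⟩ := hP
  obtain ⟨h1, h2⟩ := mem_beachEllipse_iff.1 hPS
  have hP0 := ne_zero_of_mem_beachEllipse hS hPS
  have he := norm_dir hP0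
  by_contra! hlt
  have h3 := coshDist_eq_add_ellipseGap T ρ he (norm_nonneg P)
  rw [norm_mul_dir] at h3
  have h4 := lt_ellipseRadius_of_ellipseGap_neg (p := ‖P‖) hTρ he (by linarith)
  have h5 := (ellipseRadius_mem hTρ he).1
  refine hact ⟨T, ⟨hT, hTρ.le⟩, ellipsePoint T ρ (dir P), ellipsePoint_mem hTρ he, ?_, ?_⟩
  · conv_lhs => rw [← norm_mul_dir P]
    exact arg_ofReal_mul_eq (norm_pos_iff.2 hP0) h5 _
  · rwa [ellipsePoint, norm_ofReal_mul h5.le he]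

theorem coshDist_le_of_mem_activePart {𝒮 : Finset ℂ} {S T P : ℂ} {ρ : ℝ} (hS : ‖S‖ < ρ)
    (hP : P ∈ activePart 𝒮 S ρ) (hT : T ∈ 𝒮) : coshDist P S ≤ coshDist P T := by
  rcases lt_or_ge ‖T‖ ρ with h | h
  · exact coshDist_le_of_mem_activePart_of_lt hS hP hT h
  · exact (coshDist_lt_of_mem_activePart hS hP hT h).le

/-! ### Comparing two sites along an ellipse -/

/-- The affine function of the direction `e` whose sign tells which of `S` and `T` is closer to
the point of the beach ellipse of `S` in direction `e`. -/
def bisectorForm (S T : ℂ) (ρ : ℝ) (e : ℂ) : ℝ :=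
  (sinh ρ - dot e (sinhVec S)) * (cosh ‖S‖ - cosh ‖T‖)
    - (cosh ρ - cosh ‖S‖) * dot e (sinhVec S - sinhVec T)

/-- Dividing the difference of the two `coshDist` values by `cosh p` leaves only `tanh p`, an
explicit quotient on the ellipse; clearing its denominator gives a form affine in `e`. -/
theorem exists_bisectorForm_eq {S : ℂ} (T : ℂ) {e : ℂ} {ρ : ℝ} (hS : ‖S‖ < ρ) (he : ‖e‖ = 1) :
    ∃ k > 0, bisectorForm S T ρ e =
      k * (coshDist (ellipsePoint S ρ e) S - coshDist (ellipsePoint S ρ e) T) := by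
  have ha := sinh_sub_dot_pos hS he
  set p := ellipseRadius S ρ e with hp
  have hp0 : 0 < p := (ellipseRadius_mem hS he).1
  have hc := cosh_pos p
  have hgap : ellipseGap S ρ e p = 0 := (ellipseGap_eq_zero_iff hS he).2 hp
  refine ⟨(sinh ρ - dot e (sinhVec S)) / cosh p, div_pos ha hc, ?_⟩
  rw [ellipsePoint, ← hp, coshDist_ofReal_mul S he hp0.le, coshDist_ofReal_mul T he hp0.le,
    bisectorForm, dot_sub]
  rw [ellipseGap] at hgap
  field_simp
  linear_combination (dot e (sinhVec S) - dot e (sinhVec T)) * hgap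

theorem bisectorForm_neg_iff {S T e : ℂ} {ρ : ℝ} (hS : ‖S‖ < ρ) (he : ‖e‖ = 1) :
    bisectorForm S T ρ e < 0 ↔
      coshDist (ellipsePoint S ρ e) S < coshDist (ellipsePoint S ρ e) T := by
  obtain ⟨k, hk, h⟩ := exists_bisectorForm_eq T hS he
  rw [h, mul_neg_iff, sub_neg]
  exact ⟨fun h => (h.resolve_right fun h => hk.not_gt h.1).2, fun h => Or.inl ⟨hk, h⟩⟩

theorem bisectorForm_nonpos_iff {S T e : ℂ} {ρ : ℝ} (hS : ‖S‖ < ρ) (he : ‖e‖ = 1) :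
    bisectorForm S T ρ e ≤ 0 ↔
      coshDist (ellipsePoint S ρ e) S ≤ coshDist (ellipsePoint S ρ e) T := by
  obtain ⟨k, hk, h⟩ := exists_bisectorForm_eq T hS he
  rw [h, mul_nonpos_iff, sub_nonpos]
  exact ⟨fun h => (h.resolve_right fun h => hk.not_ge h.1).2, fun h => Or.inl ⟨hk.le, h⟩⟩

theorem bisectorForm_eq (S T : ℂ) (ρ : ℝ) (e : ℂ) :
    bisectorForm S T ρ e = sinh ρ * (cosh ‖S‖ - cosh ‖T‖) +
      dot e (((cosh ρ - cosh ‖S‖ : ℝ) : ℂ) * sinhVec T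
        - ((cosh ρ - cosh ‖T‖ : ℝ) : ℂ) * sinhVec S) := by
  rw [bisectorForm, dot_sub, dot_sub, dot_mul_ofReal, dot_mul_ofReal]; ring

theorem continuous_bisectorForm (S T : ℂ) (ρ : ℝ) : Continuous (bisectorForm S T ρ) := by
  have h1 := continuous_dot_left (sinhVec S)
  have h2 := continuous_dot_left (sinhVec S - sinhVec T)
  unfold bisectorForm
  fun_prop

theorem sinhVec_injective : Function.Injective sinhVec := by
  intro A B h
  have h1 : ‖A‖ = ‖B‖ := by
    have := norm_sinhVec A
    rw [h, norm_sinhVec] at this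
    exact (sinh_injective this).symm
  rcases eq_or_ne A 0 with rfl | hA
  · rw [norm_zero] at h1
    exact (norm_eq_zero.1 h1.symm).symm
  have h2 : (sinh ‖B‖ : ℂ) ≠ 0 := by
    rw [← h1]
    exact_mod_cast (sinh_pos_iff.2 (norm_pos_iff.2 hA)).ne'
  rw [sinhVec, sinhVec, h1] at h
  rw [← norm_mul_dir A, ← norm_mul_dir B, h1, mul_left_cancel₀ h2 h]

/-- A nonzero affine function has finitely many zeros on the unit circle. -/
theorem finite_setOf_add_dot_eq_zero {a : ℝ} {b : ℂ} (h : a ≠ 0 ∨ b ≠ 0) :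
    {e : ℂ | ‖e‖ = 1 ∧ a + dot e b = 0}.Finite := by
  -- On the unit circle the conjugate of `e` is its inverse, so multiplying `2 * (a + dot e b)` by
  -- `e` gives this quadratic in `e`.
  open Polynomial in
  set q : ℂ[X] := C (starRingEnd ℂ b) * X ^ 2 + C (2 * a : ℂ) * X + C b with hq
  have hq0 : q ≠ 0 := by
    intro h0
    rcases h with h | h
    · have : q.coeff 1 = 2 * a := by simp [hq, Polynomial.coeff_C]
      rw [h0] at this
      simp at this
      exact h this
    · have : q.coeff 0 = b := by simp [hq]
      rw [h0] at this
      exact h (by simpa using this.symm)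
  refine (q.roots.toFinset.finite_toSet).subset ?_
  rintro e ⟨he, hz⟩
  simp only [Multiset.mem_toFinset, Finset.mem_coe, Polynomial.mem_roots hq0, Polynomial.IsRoot]
  have h1 : e * starRingEnd ℂ e = 1 := by
    rw [Complex.mul_conj, Complex.normSq_eq_norm_sq, he]; simp
  have h2 : (a : ℂ) * 2 + (e * starRingEnd ℂ b + starRingEnd ℂ e * b) = 0 := by
    have : (e * starRingEnd ℂ b + starRingEnd ℂ e * b) = ((2 * dot e b : ℝ) : ℂ) := by
      apply Complex.ext <;> simp [dot] <;> ring
    rw [this]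
    have : ((a + dot e b : ℝ) : ℂ) = 0 := by rw [hz]; simp
    push_cast at this ⊢
    linear_combination 2 * this
  simp only [hq, Polynomial.eval_add, Polynomial.eval_mul, Polynomial.eval_C, Polynomial.eval_pow,
    Polynomial.eval_X]
  linear_combination e * h2 - b * h1

theorem finite_setOf_bisectorForm_eq_zero {S T : ℂ} {ρ : ℝ} (hS : ‖S‖ < ρ) (hST : T ≠ S) :
    {e : ℂ | ‖e‖ = 1 ∧ bisectorForm S T ρ e = 0}.Finite := by
  simp only [bisectorForm_eq]
  apply finite_setOf_add_dot_eq_zero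
  by_cases h : cosh ‖S‖ = cosh ‖T‖
  · right
    rw [← h, ← mul_sub]
    refine mul_ne_zero ?_ (sub_ne_zero.2 fun h => hST (sinhVec_injective h))
    exact_mod_cast (cosh_sub_cosh_pos (norm_nonneg S) hS).ne'
  · left
    refine mul_ne_zero ?_ (sub_ne_zero.2 h)
    exact (sinh_pos_iff.2 (lt_of_le_of_lt (norm_nonneg S) hS)).ne'

/-! ### Strictly closest points and active segments -/

/-- `P` is closer to `S` than to any other site. -/
def StrictlyClosest (𝒮 : Finset ℂ) (S P : ℂ) : Prop :=
  ∀ T ∈ 𝒮, T ≠ S → coshDist P S < coshDist P T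

theorem StrictlyClosest.mem_activePart {𝒮 : Finset ℂ} {S P : ℂ} {ρ : ℝ} (hS : ‖S‖ < ρ)
    (hP : P ∈ beachEllipse S ρ) (h : StrictlyClosest 𝒮 S P) : P ∈ activePart 𝒮 S ρ := by
  refine mem_activePart_of_closest hS hP fun T hT => ?_
  rcases eq_or_ne T S with rfl | hTS
  · exact Or.inr ⟨le_rfl, hS⟩
  · exact Or.inl (h T hT hTS)

theorem exists_strictlyClosest_mem {𝒮 : Finset ℂ} {S : ℂ} {ρ : ℝ} (hS : ‖S‖ < ρ) {C : Set ℂ}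
    (hC : C ∈ activeSegments 𝒮 S ρ) : ∃ P ∈ C, StrictlyClosest 𝒮 S P := by
  obtain ⟨hnt, P₀, hP₀, hCeq⟩ := hC
  have hsub : C ⊆ activePart 𝒮 S ρ := hCeq ▸ connectedComponentIn_subset _ _
  have hpre : IsPreconnected C := hCeq ▸ isPreconnected_connectedComponentIn
  have hinf : C.Infinite := hpre.infinite_of_nontrivial hnt
  have hfin : (⋃ T ∈ {T | T ∈ 𝒮 ∧ T ≠ S},
      ellipsePoint S ρ '' {e : ℂ | ‖e‖ = 1 ∧ bisectorForm S T ρ e = 0}).Finite := by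
    refine Finite.biUnion (𝒮.finite_toSet.subset fun T hT => hT.1) fun T hT => ?_
    exact (finite_setOf_bisectorForm_eq_zero hS hT.2).image _
  obtain ⟨P, hPC, hP⟩ := hinf.exists_notMem_finite hfin
  refine ⟨P, hPC, fun T hT hTS => ?_⟩
  have hact := hsub hPC
  refine lt_of_le_of_ne (coshDist_le_of_mem_activePart hS hact hT) fun heq => hP ?_
  have hP0 := norm_dir (ne_zero_of_mem_beachEllipse hS hact.1)
  have hPe := eq_ellipsePoint hS hact.1
  refine mem_biUnion (show T ∈ {T | T ∈ 𝒮 ∧ T ≠ S} from ⟨hT, hTS⟩) ⟨dir P, ⟨hP0, ?_⟩, hPe.symm⟩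
  obtain ⟨k, hk, h⟩ := exists_bisectorForm_eq T hS hP0
  rw [h, ← hPe, heq, sub_self, mul_zero]

/-- Strict inequalities for finitely many sites survive a small rotation, so a whole arc of the
ellipse at `P` is active and the component is nontrivial. -/
theorem StrictlyClosest.exists_activeSegment {𝒮 : Finset ℂ} {S P : ℂ} {ρ : ℝ} (hS : ‖S‖ < ρ)
    (hP : P ∈ beachEllipse S ρ) (h : StrictlyClosest 𝒮 S P) :
    ∃ D ∈ activeSegments 𝒮 S ρ, P ∈ D := by
  have hact := h.mem_activePart hS hP
  refine ⟨_, ⟨?_, P, hact, rfl⟩, mem_connectedComponentIn hact⟩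
  have he := norm_dir (ne_zero_of_mem_beachEllipse hS hP)
  have hPe := eq_ellipsePoint hS hP
  let r : ℝ → ℂ := fun θ => Complex.exp (θ * Complex.I) * dir P
  have hr : Continuous r := by fun_prop
  have hr1 : ∀ θ, ‖r θ‖ = 1 := fun θ => by simp [r, he, Complex.norm_exp_ofReal_mul_I]
  have hr0 : r 0 = dir P := by simp [r]
  have hev : ∀ᶠ θ in nhds (0 : ℝ), ∀ T ∈ 𝒮, T ≠ S → bisectorForm S T ρ (r θ) < 0 := by
    simp only [Finset.eventually_all, Filter.eventually_imp_distrib_left]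
    intro T hT hTS
    have hc : Continuous fun θ => bisectorForm S T ρ (r θ) :=
      (continuous_bisectorForm S T ρ).comp hr
    refine hc.continuousAt.eventually_lt continuousAt_const ?_
    rw [hr0, bisectorForm_neg_iff hS he, ← hPe]
    exact h T hT hTS
  obtain ⟨δ, hδ, hball⟩ := Metric.eventually_nhds_iff.1 hev
  -- The bound `1` keeps `η` below `π`, so that the far end of the arc differs from `P`.
  set η := min (δ / 2) 1 with hη
  have hη0 : 0 < η := by positivity
  have hsub : (fun θ => ellipsePoint S ρ (r θ)) '' Icc 0 η ⊆ activePart 𝒮 S ρ := by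
    rintro _ ⟨θ, hθ, rfl⟩
    refine StrictlyClosest.mem_activePart hS (ellipsePoint_mem hS (hr1 θ)) fun T hT hTS => ?_
    refine (bisectorForm_neg_iff hS (hr1 θ)).1 (hball ?_ T hT hTS)
    rw [dist_zero_right, norm_of_nonneg hθ.1]
    linarith [hθ.2, min_le_left (δ / 2) 1]
  have hpre : IsPreconnected ((fun θ => ellipsePoint S ρ (r θ)) '' Icc 0 η) := by
    refine isPreconnected_Icc.image _ (Continuous.continuousOn ?_)
    rw [continuous_iff_continuousAt]
    intro θ
    exact ContinuousAt.comp (f := fun θ => (ρ, r θ)) (g := fun x : ℝ × ℂ => ellipsePoint S x.1 x.2)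
      (continuousAt_ellipsePoint hS (hr1 θ)) (by fun_prop)
  have hPmem : P ∈ (fun θ => ellipsePoint S ρ (r θ)) '' Icc 0 η :=
    ⟨0, ⟨le_rfl, hη0.le⟩, by simp only [hr0]; exact hPe.symm⟩
  refine Set.Nontrivial.mono ?_ (hpre.subset_connectedComponentIn hPmem hsub)
  refine ⟨P, hPmem, _, ⟨η, ⟨hη0.le, le_rfl⟩, rfl⟩, fun heq => ?_⟩
  have h1 : dir P = r η := by
    conv_lhs => rw [heq]
    exact dir_ellipsePoint hS (hr1 η)
  have h2 : Complex.exp (η * Complex.I) = 1 := by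
    have h3 : dir P ≠ 0 := by
      intro h0
      simp [h0] at he
    have : Complex.exp (η * Complex.I) * dir P = 1 * dir P := by rw [one_mul]; exact h1.symm
    exact mul_right_cancel₀ h3 this
  have h3 : sin η = 0 := by
    have := congrArg Complex.im h2
    simpa [Complex.exp_ofReal_mul_I_im] using this
  exact (sin_pos_of_pos_of_lt_pi hη0 (by linarith [min_le_right (δ / 2) 1, pi_gt_three])).ne' h3

/-! ### Pulling a point back towards its site in the Klein model -/

/-- The root in `[0, 1]` of a convex function that is nonnegative at `0` and negative at `1`
depends continuously on a parameter. -/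
theorem exists_continuousOn_root {G : ℝ → ℝ → ℝ} {I : Set ℝ}
    (hconv : ∀ ρ ∈ I, ConvexOn ℝ (Icc 0 1) (G ρ)) (hcont : ∀ ρ ∈ I, ContinuousOn (G ρ) (Icc 0 1))
    (hpar : ∀ τ, Continuous fun ρ => G ρ τ) (h0 : ∀ ρ ∈ I, 0 ≤ G ρ 0)
    (h1 : ∀ ρ ∈ I, G ρ 1 < 0) :
    ∃ τ : ℝ → ℝ, ContinuousOn τ I ∧ (∀ ρ ∈ I, τ ρ ∈ Ico 0 1 ∧ G ρ (τ ρ) = 0) ∧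
      ∀ ρ ∈ I, G ρ 0 = 0 → τ ρ = 0 := by
  have hroot : ∀ ρ, ∃ t, ρ ∈ I → t ∈ Ico (0 : ℝ) 1 ∧ G ρ t = 0 := by
    intro ρ
    by_cases hρ : ρ ∈ I
    · obtain ⟨t, ht, hGt⟩ := intermediate_value_Icc' zero_le_one (hcont ρ hρ)
        ⟨(h1 ρ hρ).le, h0 ρ hρ⟩
      refine ⟨t, fun _ => ⟨⟨ht.1, ht.2.lt_of_ne ?_⟩, hGt⟩⟩
      rintro rfl
      exact (h1 ρ hρ).ne hGt
    · exact ⟨0, fun h => absurd h hρ⟩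
  choose τ hτ using hroot
  -- Here `b` is a convex combination of `a` and `1` with positive weight on `1`. Hence the root is
  -- unique and `G ρ` changes sign there, and the signs at fixed points next to the root persist for
  -- nearby `ρ`.
  have hneg : ∀ ρ ∈ I, ∀ a b, 0 ≤ a → a < b → b ≤ 1 → G ρ a ≤ 0 → G ρ b < 0 := by
    intro ρ hρ a b ha hab hb hGa
    have hd : 0 < 1 - a := by linarith
    have hw : (1 - b) / (1 - a) + (b - a) / (1 - a) = 1 := by field_simp; ring
    have := (hconv ρ hρ).2 (show a ∈ Icc 0 1 from ⟨ha, by linarith⟩)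
      (show (1 : ℝ) ∈ Icc 0 1 from ⟨zero_le_one, le_rfl⟩)
      (show 0 ≤ (1 - b) / (1 - a) from div_nonneg (by linarith) hd.le)
      (show 0 ≤ (b - a) / (1 - a) from div_nonneg (by linarith) hd.le) hw
    have hb' : ((1 - b) / (1 - a)) • a + ((b - a) / (1 - a)) • (1 : ℝ) = b := by
      simp only [smul_eq_mul]; field_simp; ring
    rw [hb'] at this
    simp only [smul_eq_mul] at this
    have h2 : (1 - b) / (1 - a) * G ρ a ≤ 0 :=
      mul_nonpos_of_nonneg_of_nonpos (div_nonneg (by linarith) hd.le) hGa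
    have h3 : (b - a) / (1 - a) * G ρ 1 < 0 :=
      mul_neg_of_pos_of_neg (div_pos (by linarith) hd) (h1 ρ hρ)
    linarith
  refine ⟨τ, fun ρ₀ hρ₀ => ?_, fun ρ hρ => hτ ρ hρ, fun ρ hρ h => ?_⟩
  · obtain ⟨⟨h2, h3⟩, h4⟩ := hτ ρ₀ hρ₀
    refine tendsto_order.2 ⟨fun a ha => ?_, fun b hb => ?_⟩
    · rcases lt_or_ge a 0 with ha0 | ha0
      · filter_upwards [self_mem_nhdsWithin] with ρ hρ
        exact ha0.trans_le (hτ ρ hρ).1.1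
      · have hGa : 0 < G ρ₀ a := by
          by_contra! h
          exact (hneg ρ₀ hρ₀ a _ ha0 ha h3.le h).ne h4
        filter_upwards [self_mem_nhdsWithin,
          ((hpar a).continuousAt.eventually_const_lt hGa).filter_mono nhdsWithin_le_nhds]
          with ρ hρ hGρ
        by_contra! hle
        rcases hle.eq_or_lt with h | h
        · rw [← h, (hτ ρ hρ).2] at hGρ
          exact lt_irrefl _ hGρ
        · exact (hneg ρ hρ _ a (hτ ρ hρ).1.1 h (by linarith) (hτ ρ hρ).2.le).not_gt hGρ
    · rcases lt_or_ge 1 b with hb1 | hb1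
      · filter_upwards [self_mem_nhdsWithin] with ρ hρ
        exact (hτ ρ hρ).1.2.trans hb1
      · have hGb : G ρ₀ b < 0 := hneg ρ₀ hρ₀ _ b h2 hb hb1 h4.le
        filter_upwards [self_mem_nhdsWithin,
          ((hpar b).continuousAt.eventually_lt_const hGb).filter_mono nhdsWithin_le_nhds]
          with ρ hρ hGρ
        by_contra! hle
        rcases hle.eq_or_lt with h | h
        · rw [h, (hτ ρ hρ).2] at hGρ
          exact lt_irrefl _ hGρ
        · exact (hneg ρ hρ b _ (by linarith) h (hτ ρ hρ).1.2.le hGρ.le).ne (hτ ρ hρ).2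
  · obtain ⟨⟨h2, h3⟩, h4⟩ := hτ ρ hρ
    by_contra hne
    exact (hneg ρ hρ 0 _ le_rfl (lt_of_le_of_ne h2 (Ne.symm hne)) h3.le h.le).ne h4

/-- In the Klein model the beach ellipse is the zero set of this convex function. -/
def kleinGap (S : ℂ) (ρ : ℝ) (x : ℂ) : ℝ :=
  sinh ρ * ‖x‖ - dot x (sinhVec S) - cosh ρ + cosh ‖S‖

theorem dot_lineMap (a b : ℝ) (x y w : ℂ) :
    dot (a * x + b * y) w = a * dot x w + b * dot y w := by
  rw [dot_comm, dot_add, dot_mul_ofReal, dot_mul_ofReal, dot_comm w, dot_comm w]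

theorem kleinGap_combo_le (S : ℂ) {ρ : ℝ} (hρ : 0 ≤ ρ) {a b : ℝ} (ha : 0 ≤ a) (hb : 0 ≤ b)
    (hab : a + b = 1) (x y : ℂ) :
    kleinGap S ρ (a * x + b * y) ≤ a * kleinGap S ρ x + b * kleinGap S ρ y := by
  have h1 : ‖(a : ℂ) * x + b * y‖ ≤ a * ‖x‖ + b * ‖y‖ := by
    refine (norm_add_le _ _).trans ?_
    rw [norm_mul, norm_mul, Complex.norm_real, Complex.norm_real, norm_of_nonneg ha,
      norm_of_nonneg hb]
  have h2 := mul_le_mul_of_nonneg_left h1 (sinh_nonneg_iff.2 hρ)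
  simp only [kleinGap, dot_lineMap]
  have h3 : cosh ρ = a * cosh ρ + b * cosh ρ := by rw [← add_mul, hab, one_mul]
  have h4 : cosh ‖S‖ = a * cosh ‖S‖ + b * cosh ‖S‖ := by rw [← add_mul, hab, one_mul]
  linarith

/-- The point of the Klein model that corresponds to `A`. -/
def klein (A : ℂ) : ℂ := ((cosh ‖A‖)⁻¹ : ℝ) * sinhVec A

/-- The factor `cosh ‖A‖` is common to all `B`, so comparing the distances to two sites is an affine
condition on `klein A`: bisectors are straight. -/
theorem coshDist_eq_klein (A B : ℂ) :
    coshDist A B = cosh ‖A‖ * (cosh ‖B‖ - dot (klein A) (sinhVec B)) := by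
  have := (cosh_pos ‖A‖).ne'
  rw [coshDist, klein, dot_ofReal_mul]; field_simp

theorem kleinGap_klein (S A : ℂ) (ρ : ℝ) :
    cosh ‖A‖ * kleinGap S ρ (klein A) = coshDist A S - cosh (ρ - ‖A‖) := by
  have h := cosh_pos ‖A‖
  have h1 : ‖klein A‖ = (cosh ‖A‖)⁻¹ * sinh ‖A‖ := by
    rw [klein, norm_mul, norm_sinhVec, Complex.norm_real, norm_of_nonneg (inv_pos.2 h).le]
  rw [coshDist_eq_klein, kleinGap, h1, cosh_sub]
  field_simp
  ring

theorem coshDist_self (S : ℂ) : coshDist S S = 1 := by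
  rw [coshDist, dot_self, norm_sinhVec]; linarith [cosh_sq ‖S‖]

/-- Ellipses grow with the sweep radius: a point on a later ellipse is not inside an earlier one. -/
theorem kleinGap_nonneg {S P : ℂ} {r ρ : ℝ} (hS : ‖S‖ < ρ) (hρ : ρ ≤ r)
    (hP : P ∈ beachEllipse S r) : 0 ≤ kleinGap S ρ (klein P) := by
  obtain ⟨h1, h2⟩ := mem_beachEllipse_iff.1 hP
  have h3 := cosh_norm_sub_le_coshDist P S
  rw [h2, cosh_le_cosh, abs_of_nonneg (by linarith : 0 ≤ r - ‖P‖)] at h3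
  have h4 := le_abs_self (‖P‖ - ‖S‖)
  have h5 : cosh (ρ - ‖P‖) ≤ cosh (r - ‖P‖) := by
    rw [cosh_le_cosh, abs_of_nonneg (by linarith : 0 ≤ r - ‖P‖), abs_le]
    constructor <;> linarith
  have h6 := kleinGap_klein S P ρ
  rw [h2] at h6
  exact nonneg_of_mul_nonneg_right (by linarith) (cosh_pos ‖P‖)

theorem kleinGap_self_neg {S : ℂ} {ρ : ℝ} (hS : ‖S‖ < ρ) : kleinGap S ρ (klein S) < 0 := by
  have h6 := kleinGap_klein S S ρ
  rw [coshDist_self] at h6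
  have h1 : 1 < cosh (ρ - ‖S‖) := one_lt_cosh.2 (by linarith)
  by_contra! h
  linarith [mul_nonneg (cosh_pos ‖S‖).le h]

theorem ne_zero_of_kleinGap_eq_zero {S x : ℂ} {ρ : ℝ} (hS : ‖S‖ < ρ) (hx : kleinGap S ρ x = 0) :
    x ≠ 0 := by
  rintro rfl
  have : dot 0 (sinhVec S) = 0 := by simp [dot]
  rw [kleinGap, norm_zero, this] at hx
  linarith [cosh_sub_cosh_pos (norm_nonneg S) hS]

theorem klein_ellipsePoint {S x : ℂ} {ρ : ℝ} (hS : ‖S‖ < ρ) (hx : kleinGap S ρ x = 0) :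
    klein (ellipsePoint S ρ (dir x)) = x := by
  have hx0 := ne_zero_of_kleinGap_eq_zero hS hx
  have he := norm_dir hx0
  have hr := (ellipseRadius_mem hS he).1
  have hc := cosh_pos (ellipseRadius S ρ (dir x))
  have ht : tanh (ellipseRadius S ρ (dir x)) = ‖x‖ := by
    rw [tanh_ellipseRadius hS he, div_eq_iff (sinh_sub_dot_pos hS he).ne']
    rw [kleinGap] at hx
    have : dot x (sinhVec S) = ‖x‖ * dot (dir x) (sinhVec S) := by
      rw [← dot_ofReal_mul, norm_mul_dir]
    linarith
  rw [klein, ellipsePoint, norm_ofReal_mul hr.le he, sinhVec_ofReal_mul hr.le he, ← mul_assoc,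
    ← Complex.ofReal_mul, inv_mul_eq_div, ← tanh_eq_sinh_div_cosh, ht, norm_mul_dir]

theorem dir_klein (A : ℂ) : dir (klein A) = dir A := by
  rcases eq_or_ne A 0 with rfl | hA
  · simp [klein, sinhVec, dir]
  · rw [klein, sinhVec, ← mul_assoc, ← Complex.ofReal_mul]
    refine dir_ofReal_mul (mul_pos (inv_pos.2 (cosh_pos _)) ?_) (norm_dir hA)
    exact sinh_pos_iff.2 (norm_pos_iff.2 hA)

/-- Moving straight towards `S`, a point that is closest to `S` stays so, and passes through the
beach ellipses of `S` for all smaller sweep radii. -/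
theorem StrictlyClosest.exists_path {𝒮 : Finset ℂ} {S P : ℂ} {r₁ r₂ : ℝ} (hS : ‖S‖ < r₁)
    (hr : r₁ ≤ r₂) (hP : P ∈ beachEllipse S r₂) (h : StrictlyClosest 𝒮 S P) :
    ∃ γ : ℝ → ℂ, ContinuousOn γ (Icc r₁ r₂) ∧ γ r₂ = P ∧
      ∀ ρ ∈ Icc r₁ r₂, γ ρ ∈ beachEllipse S ρ ∧ StrictlyClosest 𝒮 S (γ ρ) := by
  let x : ℝ → ℂ := fun τ => ((1 - τ : ℝ) : ℂ) * klein P + τ * klein S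
  have hx0 : x 0 = klein P := by simp [x]
  have hx1 : x 1 = klein S := by simp [x]
  have hxc : Continuous x := by fun_prop
  have hρ0 : ∀ ρ ∈ Icc r₁ r₂, 0 ≤ ρ := fun ρ hρ => by linarith [hρ.1, norm_nonneg S]
  obtain ⟨τ, hτc, hτ, hτ0⟩ := exists_continuousOn_root (G := fun ρ τ => kleinGap S ρ (x τ))
    (I := Icc r₁ r₂) (fun ρ hρ => ⟨convex_Icc 0 1, fun a _ b _ u v hu hv huv => by
      have := kleinGap_combo_le S (hρ0 ρ hρ) hu hv huv (x a) (x b)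
      have hxx : (u : ℂ) * x a + v * x b = x (u • a + v • b) := by
        have huv' : (u : ℂ) + v = 1 := by exact_mod_cast huv
        simp only [x, smul_eq_mul]
        push_cast
        linear_combination klein P * huv'
      rwa [hxx] at this⟩)
    (fun ρ _ => by
      have := (continuous_dot_left (sinhVec S)).comp hxc
      unfold kleinGap
      exact (((continuous_const.mul hxc.norm).sub this).sub continuous_const).add
        continuous_const |>.continuousOn)
    (fun τ => by unfold kleinGap; fun_prop)
    (fun ρ hρ => by rw [hx0]; exact kleinGap_nonneg (hS.trans_le hρ.1) hρ.2 hP)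
    (fun ρ hρ => by rw [hx1]; exact kleinGap_self_neg (hS.trans_le hρ.1))
  refine ⟨fun ρ => ellipsePoint S ρ (dir (x (τ ρ))), fun ρ hρ => ?_, ?_, fun ρ hρ => ?_⟩
  · have hS' := hS.trans_le hρ.1
    have hne := ne_zero_of_kleinGap_eq_zero hS' (hτ ρ hρ).2
    refine ContinuousAt.comp_continuousWithinAt (f := fun ρ => (ρ, dir (x (τ ρ))))
      (g := fun x : ℝ × ℂ => ellipsePoint S x.1 x.2)
      (continuousAt_ellipsePoint hS' (norm_dir hne)) ?_
    refine continuousWithinAt_id.prodMk ?_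
    have hxτ : ContinuousWithinAt (fun ρ => x (τ ρ)) (Icc r₁ r₂) ρ :=
      ContinuousAt.comp_continuousWithinAt (g := x) hxc.continuousAt (hτc ρ hρ)
    exact ContinuousAt.comp_continuousWithinAt (g := dir) (continuousAt_dir hne) hxτ
  · have hr₂ : r₂ ∈ Icc r₁ r₂ := ⟨hr, le_rfl⟩
    have h1 : kleinGap S r₂ (x 0) = 0 := by
      have := kleinGap_klein S P r₂
      rw [(mem_beachEllipse_iff.1 hP).2, sub_self] at this
      rw [hx0]
      exact (mul_eq_zero.1 this).resolve_left (cosh_pos _).ne'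
    simp only
    rw [hτ0 r₂ hr₂ h1, hx0, dir_klein]
    exact (eq_ellipsePoint (hS.trans_le hr) hP).symm
  · have hS' := hS.trans_le hρ.1
    have hgap := (hτ ρ hρ).2
    have hne := ne_zero_of_kleinGap_eq_zero hS' hgap
    refine ⟨ellipsePoint_mem hS' (norm_dir hne), fun T hT hTS => ?_⟩
    rw [coshDist_eq_klein, coshDist_eq_klein, klein_ellipsePoint hS' hgap]
    refine mul_lt_mul_of_pos_left ?_ (cosh_pos _)
    have hPT := h T hT hTS
    rw [coshDist_eq_klein, coshDist_eq_klein] at hPT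
    have hPT := lt_of_mul_lt_mul_left hPT (cosh_pos _).le
    -- The affine comparison of `S` with `T` is strict at `P` and weak at `S`. As `τ ρ < 1`, the end
    -- at `P` has positive weight and strictness survives.
    have hST : coshDist S S ≤ coshDist S T := by
      rw [coshDist_self]; exact one_le_coshDist S T
    rw [coshDist_eq_klein, coshDist_eq_klein] at hST
    have hST := le_of_mul_le_mul_left hST (cosh_pos _)
    obtain ⟨ht0, ht1⟩ := (hτ ρ hρ).1
    simp only [x, dot_lineMap]
    nlinarith [mul_lt_mul_of_pos_left hPT (by linarith : 0 < 1 - τ ρ),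
      mul_le_mul_of_nonneg_left hST ht0]

/-- An active segment of a site that was seen at `r₁` continues some segment active at `r₁`. -/
theorem exists_continues {𝒮 : Finset ℂ} {S : ℂ} {r₁ r₂ : ℝ} (hS : ‖S‖ < r₁) (hr : r₁ ≤ r₂)
    {C : Set ℂ} (hC : C ∈ activeSegments 𝒮 S r₂) :
    ∃ C' ∈ activeSegments 𝒮 S r₁, Continues 𝒮 S r₁ C' r₂ C := by
  obtain ⟨P, hPC, hP⟩ := exists_strictlyClosest_mem (hS.trans_le hr) hC
  have hPE : P ∈ beachEllipse S r₂ := by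
    obtain ⟨-, P₀, -, rfl⟩ := hC
    exact (connectedComponentIn_subset _ _ hPC).1
  obtain ⟨γ, hγc, hγ₂, hγ⟩ := hP.exists_path hS hr hPE
  have hseg : ∀ ρ ∈ Icc r₁ r₂, ∃ D ∈ activeSegments 𝒮 S ρ, γ ρ ∈ D := fun ρ hρ =>
    (hγ ρ hρ).2.exists_activeSegment (hS.trans_le hρ.1) (hγ ρ hρ).1
  obtain ⟨C', hC', hmem⟩ := hseg r₁ ⟨le_rfl, hr⟩
  exact ⟨C', hC', γ, hγc, hseg, hmem, hγ₂ ▸ hPC⟩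

/-! ### Arcs, chords and connected subsets of the unit circle -/

theorem isPreconnected_unitCircle_halfPlane (a : ℝ) (b : ℂ) :
    IsPreconnected {x : ℂ | ‖x‖ = 1 ∧ 0 ≤ a + dot x b} := by
  have hexp : ∀ z : ℂ, z ≠ 0 → ∀ x : ℂ, ‖x‖ = 1 →
      x = dir z * Complex.exp (Complex.arg (x / dir z) * Complex.I) := by
    intro z hz x hx
    have h1 : dir z ≠ 0 := norm_ne_zero_iff.1 (by rw [norm_dir hz]; exact one_ne_zero)
    have h2 := Complex.norm_mul_exp_arg_mul_I (x / dir z)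
    rw [norm_div, hx, norm_dir hz, div_one, Complex.ofReal_one, one_mul] at h2
    rw [h2]; field_simp
  have hdot : ∀ z : ℂ, z ≠ 0 → ∀ θ : ℝ,
      dot (dir z * Complex.exp (θ * Complex.I)) z = ‖z‖ * cos θ := by
    intro z hz θ
    have h1 := dot_self (dir z)
    rw [norm_dir hz] at h1
    conv_lhs => arg 2; rw [← norm_mul_dir z]
    rw [dot_mul_ofReal, Complex.exp_mul_I, ← Complex.ofReal_cos, ← Complex.ofReal_sin]
    congr 1
    simp only [dot, Complex.mul_re, Complex.mul_im, Complex.add_re, Complex.add_im,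
      Complex.ofReal_re, Complex.ofReal_im, Complex.I_re, Complex.I_im] at h1 ⊢
    linear_combination cos θ * h1
  have hnorm : ∀ z : ℂ, z ≠ 0 → ∀ θ : ℝ, ‖dir z * Complex.exp (θ * Complex.I)‖ = 1 := by
    intro z hz θ
    rw [norm_mul, norm_dir hz, Complex.norm_exp_ofReal_mul_I, one_mul]
  have hcont : ∀ z : ℂ, Continuous fun θ : ℝ => dir z * Complex.exp (θ * Complex.I) := by
    intro z; fun_prop
  rcases eq_or_ne b 0 with rfl | hb
  · have h0 : ∀ x : ℂ, dot x 0 = 0 := fun x => by simp [dot]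
    rcases lt_or_ge a 0 with ha | ha
    · convert isPreconnected_empty (α := ℂ)
      rw [eq_empty_iff_forall_notMem]
      rintro x ⟨-, hx⟩
      rw [h0] at hx
      linarith
    · convert (isPreconnected_univ (α := ℝ)).image _ (hcont 1).continuousOn
      ext x
      constructor
      · rintro ⟨hx, -⟩
        exact ⟨_, mem_univ _, (hexp 1 one_ne_zero x hx).symm⟩
      · rintro ⟨θ, -, rfl⟩
        exact ⟨hnorm 1 one_ne_zero θ, by rw [h0]; linarith⟩
  · have hb' : 0 < ‖b‖ := norm_pos_iff.2 hb
    -- With angles measured from `b`, the half-plane condition reads `c ≤ cos θ`, so the set is the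
    -- image of the interval `[-arccos c, arccos c]`, or empty if `1 < c`. For `c ≤ -1` this
    -- interval is `[-π, π]`, the full circle.
    set c := -a / ‖b‖ with hc
    have hiff : ∀ θ : ℝ, 0 ≤ a + dot (dir b * Complex.exp (θ * Complex.I)) b ↔ c ≤ cos θ := by
      intro θ
      rw [hdot b hb, hc, div_le_iff₀ hb']
      constructor <;> intro h <;> linarith
    rcases lt_or_ge 1 c with h1 | h1
    · convert isPreconnected_empty (α := ℂ)
      rw [eq_empty_iff_forall_notMem]
      rintro x ⟨hx, hx2⟩
      rw [hexp b hb x hx, hiff] at hx2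
      linarith [cos_le_one (Complex.arg (x / dir b))]
    · convert (isPreconnected_Icc (a := - arccos c) (b := arccos c)).image _ (hcont b).continuousOn
      ext x
      constructor
      · rintro ⟨hx, hx2⟩
        refine ⟨Complex.arg (x / dir b), ?_, (hexp b hb x hx).symm⟩
        rw [hexp b hb x hx, hiff, ← cos_abs] at hx2
        rw [mem_Icc, ← abs_le]
        have := arccos_le_arccos hx2
        rwa [arccos_cos (abs_nonneg _) (Complex.abs_arg_le_pi _)] at this
      · rintro ⟨θ, hθ, rfl⟩
        refine ⟨hnorm b hb θ, (hiff θ).2 ?_⟩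
        rw [mem_Icc, ← abs_le] at hθ
        rcases le_or_gt c (-1) with h2 | h2
        · linarith [neg_one_le_cos θ]
        · rw [← cos_abs, ← cos_arccos h2.le h1]
          exact cos_le_cos_of_nonneg_of_le_pi (abs_nonneg _) (arccos_le_pi _) hθ

/-- Signed area that tells on which side of the line through `e` and `f` the point `x` lies. -/
def side (e f x : ℂ) : ℝ := (f.re - e.re) * (x.im - e.im) - (f.im - e.im) * (x.re - e.re)

theorem side_eq (e f x : ℂ) :
    side e f x = (f.im * e.re - f.re * e.im) + dot x ⟨e.im - f.im, f.re - e.re⟩ := by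
  simp only [side, dot]; ring

theorem continuous_side (e f : ℂ) : Continuous (side e f) := by
  unfold side; fun_prop

theorem side_combo (e f x y : ℂ) (a b : ℝ) (h : a + b = 1) :
    side e f (a * x + b * y) = a * side e f x + b * side e f y := by
  obtain rfl : a = 1 - b := by linarith
  simp only [side, Complex.add_re, Complex.add_im, Complex.re_ofReal_mul, Complex.im_ofReal_mul]
  ring

/-- A chord of the unit circle that meets the line through two points `e`, `f` of the circle meets
it between `e` and `f`. -/
theorem exists_chords_cross {e f x w : ℂ} (he : ‖e‖ = 1) (hf : ‖f‖ = 1) (hef : e ≠ f)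
    (hx : ‖x‖ = 1) (hw : ‖w‖ = 1) (h1 : 0 ≤ side e f x) (h2 : side e f w ≤ 0) :
    ∃ a b c d : ℝ, 0 ≤ a ∧ 0 ≤ b ∧ 0 ≤ c ∧ 0 ≤ d ∧ a + b = 1 ∧ c + d = 1 ∧
      (a : ℂ) * x + b * w = c * e + d * f := by
  obtain ⟨a, b, ha, hb, hab, hz⟩ : ∃ a b : ℝ, 0 ≤ a ∧ 0 ≤ b ∧ a + b = 1 ∧
      side e f (a * x + b * w) = 0 := by
    rcases h1.eq_or_lt with h1 | h1
    · exact ⟨1, 0, zero_le_one, le_rfl, by norm_num, by simp [← h1]⟩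
    · have hd : 0 < side e f x - side e f w := by linarith
      have hsum : -side e f w / (side e f x - side e f w) +
          side e f x / (side e f x - side e f w) = 1 := by field_simp; ring
      refine ⟨-side e f w / (side e f x - side e f w), side e f x / (side e f x - side e f w),
        div_nonneg (by linarith) hd.le, div_nonneg h1.le hd.le, hsum, ?_⟩
      rw [side_combo _ _ _ _ _ _ hsum]
      ring
  set z : ℂ := (a : ℂ) * x + b * w with hzdef
  have hzn : ‖z‖ ≤ 1 := by
    refine (norm_add_le _ _).trans ?_
    rw [norm_mul, norm_mul, Complex.norm_real, Complex.norm_real, norm_of_nonneg ha,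
      norm_of_nonneg hb, hx, hw]
    linarith
  have hN : 0 < dot (f - e) (f - e) := by
    rw [dot_self]
    have : 0 < ‖f - e‖ := norm_pos_iff.2 (sub_ne_zero.2 hef.symm)
    positivity
  -- The coordinate of `z` on the line through `e` and `f`, found by orthogonal projection.
  set d := dot (z - e) (f - e) / dot (f - e) (f - e) with hd
  have hre : z.re - e.re = d * (f.re - e.re) := by
    rw [hd, div_mul_eq_mul_div, eq_div_iff hN.ne']
    simp only [dot, side, Complex.sub_re, Complex.sub_im] at hz ⊢
    linear_combination - (f.im - e.im) * hz
  have him : z.im - e.im = d * (f.im - e.im) := by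
    rw [hd, div_mul_eq_mul_div, eq_div_iff hN.ne']
    simp only [dot, side, Complex.sub_re, Complex.sub_im] at hz ⊢
    linear_combination (f.re - e.re) * hz
  -- On this line `‖z‖ ^ 2 - 1` equals `d * (d - 1) * ‖f - e‖ ^ 2`, and `z` lies in the unit disk.
  have hquad : d * (d - 1) ≤ 0 := by
    have e1 := dot_self e
    have e2 := dot_self f
    have e3 := dot_self z
    have e4 : ‖z‖ ^ 2 ≤ 1 := by
      have := norm_nonneg z
      nlinarith
    rw [he] at e1
    rw [hf] at e2
    have hzre : z.re = e.re + d * (f.re - e.re) := by linarith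
    have hzim : z.im = e.im + d * (f.im - e.im) := by linarith
    have : d * (d - 1) * dot (f - e) (f - e) ≤ 0 := by
      rw [← e3] at e4
      simp only [dot, Complex.sub_re, Complex.sub_im, hzre, hzim] at e1 e2 e4 ⊢
      linear_combination e4 - (1 - d) * e1 - d * e2
    exact nonpos_of_mul_nonpos_left this hN
  have hd0 : 0 ≤ d := by nlinarith
  have hd1 : d ≤ 1 := by nlinarith
  refine ⟨a, b, 1 - d, d, ha, hb, by linarith, hd0, hab, by ring, ?_⟩
  rw [← hzdef]
  apply Complex.ext
  · simp only [Complex.add_re, Complex.re_ofReal_mul]; linarith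
  · simp only [Complex.add_im, Complex.im_ofReal_mul]; linarith

theorem eq_or_eq_of_side_eq_zero {e f x : ℂ} (he : ‖e‖ = 1) (hf : ‖f‖ = 1) (hef : e ≠ f)
    (hx : ‖x‖ = 1) (h : side e f x = 0) : x = e ∨ x = f := by
  obtain ⟨a, b, c, d, ha, hb, hc, hd, hab, hcd, hz⟩ :=
    exists_chords_cross he hf hef hx hx h.ge h.le
  have hxz : x = c * e + d * f := by
    rw [← hz, ← add_mul, ← Complex.ofReal_add, hab, Complex.ofReal_one, one_mul]
  have e1 := dot_self e
  have e2 := dot_self f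
  have e3 := dot_self x
  rw [he] at e1
  rw [hf] at e2
  rw [hx, hxz] at e3
  have hN : dot (f - e) (f - e) ≠ 0 := by
    rw [dot_self]
    simpa using sub_ne_zero.2 hef.symm
  obtain rfl : c = 1 - d := by linarith
  have : d * (d - 1) * dot (f - e) (f - e) = 0 := by
    simp only [dot, Complex.sub_re, Complex.sub_im, Complex.add_re, Complex.add_im,
      Complex.re_ofReal_mul, Complex.im_ofReal_mul] at e1 e2 e3 ⊢
    linear_combination e3 - (1 - d) * e1 - d * e2
  rcases mul_eq_zero.1 ((mul_eq_zero.1 this).resolve_right hN) with h | h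
  · left; rw [hxz, h]; simp
  · right; rw [hxz, show d = 1 by linarith]; simp

theorem side_swap (e f x : ℂ) : side f e x = - side e f x := by
  simp only [side]; ring

theorem add_dot_combo (a : ℝ) (b x y : ℂ) {u v : ℝ} (h : u + v = 1) :
    a + dot (u * x + v * y) b = u * (a + dot x b) + v * (a + dot y b) := by
  obtain rfl : u = 1 - v := by linarith
  rw [dot_lineMap]; ring

/-- If an affine function is positive at two points of the unit circle but not at `e` and `f`,
then these two points lie on the same side of the chord from `e` to `f`. -/
theorem side_pos_of_add_dot_pos {a : ℝ} {b e f x w : ℂ} (he : ‖e‖ = 1) (hf : ‖f‖ = 1)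
    (hef : e ≠ f) (hx : ‖x‖ = 1) (hw : ‖w‖ = 1) (hae : a + dot e b ≤ 0) (haf : a + dot f b ≤ 0)
    (hax : 0 < a + dot x b) (haw : 0 < a + dot w b) (h : 0 ≤ side e f x) : 0 < side e f w := by
  by_contra! h2
  obtain ⟨k, l, c, d, hk, hl, hc, hd, hkl, hcd, hz⟩ := exists_chords_cross he hf hef hx hw h h2
  have h3 := add_dot_combo a b x w hkl
  rw [hz, add_dot_combo a b e f hcd] at h3
  have h4 : 0 < k * (a + dot x b) + l * (a + dot w b) := by
    rcases hk.eq_or_lt with h0 | h0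
    · rw [← h0, zero_mul, zero_add, show l = 1 by linarith, one_mul]; exact haw
    · have := mul_pos h0 hax
      have := mul_nonneg hl haw.le
      linarith
  have := mul_nonpos_of_nonneg_of_nonpos hc hae
  have := mul_nonpos_of_nonneg_of_nonpos hd haf
  linarith

/-- A preconnected subset of the unit circle cannot cross a chord without containing one of its
end points. -/
theorem not_separated_by_chord {M : Set ℂ} (hM : IsPreconnected M)
    (hM1 : ∀ x ∈ M, ‖x‖ = 1) {v w e f : ℂ} (hv : ‖v‖ = 1) (hw : ‖w‖ = 1) (hvM : v ∉ M) (hwM : w ∉ M)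
    (he : e ∈ M) (hf : f ∈ M) (hef : e ≠ f) (h1 : 0 < side e f v) (h2 : side e f w < 0) :
    False := by
  have hvw : v ≠ w := by
    rintro rfl
    linarith
  obtain ⟨k, l, c, d, hk, hl, hc, hd, hkl, hcd, hz⟩ :=
    exists_chords_cross (hM1 e he) (hM1 f hf) hef hv hw h1.le h2.le
  have hcross : c * side v w e + d * side v w f = 0 := by
    rw [← side_combo v w e f c d hcd, ← hz, side_combo v w v w k l hkl]
    simp only [side]; ring
  -- The line through `v` and `w` meets the circle only there, so the connected set `M` stays on one
  -- side of it. But the chord from `e` to `f` crosses that line.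
  have hne : ∀ x ∈ M, side v w x ≠ 0 := by
    intro x hx h
    rcases eq_or_eq_of_side_eq_zero hv hw hvw (hM1 x hx) h with rfl | rfl
    · exact hvM hx
    · exact hwM hx
  have himg := (hM.image _ (continuous_side v w).continuousOn).ordConnected
  have hzero : ∀ x ∈ M, ∀ y ∈ M, side v w x ≤ 0 → 0 ≤ side v w y → False := by
    intro x hx y hy hx0 hy0
    obtain ⟨m, hm, hm0⟩ := himg.out ⟨x, hx, rfl⟩ ⟨y, hy, rfl⟩ ⟨hx0, hy0⟩
    exact hne m hm hm0
  rcases le_total (side v w e) 0 with h3 | h3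
  · rcases le_total (side v w f) 0 with h4 | h4
    · have h3 := lt_of_le_of_ne h3 (hne e he)
      have h4 := lt_of_le_of_ne h4 (hne f hf)
      rcases hc.eq_or_lt with h0 | h0
      · rw [← h0, show d = 1 by linarith] at hcross; linarith
      · linarith [mul_neg_of_pos_of_neg h0 h3, mul_nonpos_of_nonneg_of_nonpos hd h4.le]
    · exact hzero e he f hf h3 h4
  · rcases le_total (side v w f) 0 with h4 | h4
    · exact hzero f hf e he h4 h3
    · have h3 := lt_of_le_of_ne h3 (hne e he).symm
      have h4 := lt_of_le_of_ne h4 (hne f hf).symm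
      rcases hc.eq_or_lt with h0 | h0
      · rw [← h0, show d = 1 by linarith] at hcross; linarith
      · linarith [mul_pos h0 h3, mul_nonneg hd h4.le]

/-- The set of unit vectors where a family of affine functions is nonpositive: two of its points
are connected in it if they are connected on the unit circle within the complement of a set of
barriers, one for each function, where the function is positive. -/
theorem exists_isPreconnected_nonpos {ι : Type*} {J : Set ι} {a : ι → ℝ} {b w : ι → ℂ}
    (hw : ∀ i ∈ J, ‖w i‖ = 1) (hpos : ∀ i ∈ J, 0 < a i + dot (w i) (b i))
    {M : Set ℂ} (hM : IsPreconnected M) (hM1 : ∀ x ∈ M, ‖x‖ = 1) (hMw : ∀ i ∈ J, w i ∉ M)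
    {e f : ℂ} (he : e ∈ M) (hf : f ∈ M) (hea : ∀ i ∈ J, a i + dot e (b i) ≤ 0)
    (hfa : ∀ i ∈ J, a i + dot f (b i) ≤ 0) :
    ∃ N : Set ℂ, IsPreconnected N ∧ e ∈ N ∧ f ∈ N ∧
      ∀ x ∈ N, ‖x‖ = 1 ∧ ∀ i ∈ J, a i + dot x (b i) ≤ 0 := by
  rcases eq_or_ne e f with rfl | hef
  · exact ⟨{e}, isPreconnected_singleton, rfl, rfl, fun x hx => by
      rw [mem_singleton_iff.1 hx]; exact ⟨hM1 e he, hea⟩⟩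
  have he1 := hM1 e he
  have hf1 := hM1 f hf
  have hpre : ∀ g h : ℂ, IsPreconnected {x | ‖x‖ = 1 ∧ 0 ≤ side g h x} := by
    intro g h
    simp only [side_eq]
    exact isPreconnected_unitCircle_halfPlane _ _
  have hse : side e f e = 0 := by simp [side]
  have hsf : side e f f = 0 := by simp only [side]; ring
  -- The candidates for `N` are the two arcs between `e` and `f`. If each contains a point where
  -- some function is positive, the barriers of these functions lie on the same respective sides of
  -- the chord and separate `e` from `f` in `M`.
  by_cases hN₁ : ∀ x : ℂ, ‖x‖ = 1 → 0 ≤ side e f x → ∀ i ∈ J, a i + dot x (b i) ≤ 0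
  · exact ⟨_, hpre e f, ⟨he1, hse.ge⟩, ⟨hf1, hsf.ge⟩, fun x hx => ⟨hx.1, hN₁ x hx.1 hx.2⟩⟩
  by_cases hN₂ : ∀ x : ℂ, ‖x‖ = 1 → 0 ≤ side f e x → ∀ i ∈ J, a i + dot x (b i) ≤ 0
  · exact ⟨_, hpre f e, ⟨he1, by rw [side_swap, hse, neg_zero]⟩,
      ⟨hf1, by rw [side_swap, hsf, neg_zero]⟩, fun x hx => ⟨hx.1, hN₂ x hx.1 hx.2⟩⟩
  push Not at hN₁ hN₂
  obtain ⟨x, hx, hx0, i, hi, hix⟩ := hN₁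
  obtain ⟨y, hy, hy0, j, hj, hjy⟩ := hN₂
  have h1 := side_pos_of_add_dot_pos he1 hf1 hef hx (hw i hi) (hea i hi) (hfa i hi) hix
    (hpos i hi) hx0
  have h2 := side_pos_of_add_dot_pos hf1 he1 hef.symm hy (hw j hj) (hfa j hj) (hea j hj) hjy
    (hpos j hj) hy0
  rw [side_swap] at h2
  exact (not_separated_by_chord hM hM1 (hw i hi) (hw j hj) (hMw i hi) (hMw j hj) he hf hef
    h1 (by linarith)).elim

/-! ### Barriers, and why segments do not split -/

/-- A direction in which the beach ellipse of `T` is farther out than the one of `S`, for all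
sweep radii larger than the radii of both sites. -/
def barrier (S T : ℂ) : ℂ := if ‖S‖ < ‖T‖ then dir T else -dir S

theorem norm_barrier {S T : ℂ} (hST : T ≠ S) : ‖barrier S T‖ = 1 := by
  unfold barrier
  split_ifs with h
  · refine norm_dir fun h0 => ?_
    rw [h0, norm_zero] at h
    exact (norm_nonneg S).not_gt h
  · rw [norm_neg]
    refine norm_dir fun h0 => hST ?_
    rw [h0, norm_zero, not_lt] at h
    rw [h0, norm_le_zero_iff.1 h]

/-- By the sum-to-product formulas the difference of the two sides is a positive multiple of a
product of three `sinh` values. For `0 ≤ s` it says that chords of the hyperbola `(cosh, sinh)` from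
a fixed point get flatter. -/
theorem sinh_sub_mul_cosh_sub_lt {s t ρ : ℝ} (hst : s < t) (htρ : t < ρ) :
    (sinh ρ - sinh s) * (cosh t - cosh s) < (cosh ρ - cosh s) * (sinh t - sinh s) := by
  have hc : ∀ a b : ℝ, cosh a - cosh b = 2 * sinh ((a + b) / 2) * sinh ((a - b) / 2) := by
    intro a b
    have h1 : cosh a = cosh ((a + b) / 2 + (a - b) / 2) := by congr 1; ring
    have h2 : cosh b = cosh ((a + b) / 2 - (a - b) / 2) := by congr 1; ring
    rw [h1, h2, cosh_add, cosh_sub]; ring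
  have hs : ∀ a b : ℝ, sinh a - sinh b = 2 * cosh ((a + b) / 2) * sinh ((a - b) / 2) := by
    intro a b
    have h1 : sinh a = sinh ((a + b) / 2 + (a - b) / 2) := by congr 1; ring
    have h2 : sinh b = sinh ((a + b) / 2 - (a - b) / 2) := by congr 1; ring
    rw [h1, h2, sinh_add, sinh_sub]; ring
  have p1 : 0 < sinh ((ρ - s) / 2) := sinh_pos_iff.2 (by linarith)
  have p2 : 0 < sinh ((t - s) / 2) := sinh_pos_iff.2 (by linarith)
  have p3 : 0 < sinh ((ρ + s) / 2 - (t + s) / 2) := sinh_pos_iff.2 (by linarith)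
  have p4 := mul_pos (mul_pos p1 p2) p3
  rw [sinh_sub] at p4
  rw [hc, hc, hs, hs]
  linear_combination 4 * p4

/-- If `‖S‖ < ‖T‖`, the worst case has `S` in the direction of `T`, and the chord inequality
decides. Otherwise the form is a sum of two nonnegative terms; the first is positive if the norms
differ, the second if they agree, since then `T` is not in the direction of `S`. -/
theorem bisectorForm_barrier_pos {S T : ℂ} {ρ : ℝ} (hST : T ≠ S) (hS : ‖S‖ < ρ) (hT : ‖T‖ < ρ) :
    0 < bisectorForm S T ρ (barrier S T) := by
  have hnorm := norm_barrier hST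
  have hb := cosh_sub_cosh_pos (norm_nonneg S) hS
  unfold barrier at hnorm ⊢
  split_ifs at hnorm ⊢ with h
  · have h1 : dot (dir T) (sinhVec T) = sinh ‖T‖ := by
      rw [sinhVec, dot_mul_ofReal, dot_self, hnorm, one_pow, mul_one]
    have h2 := dot_sinhVec_le S hnorm
    have h3 := cosh_sub_cosh_pos (norm_nonneg T) hT
    have h4 := sinh_sub_mul_cosh_sub_lt h hT
    rw [bisectorForm, dot_sub, h1]
    linear_combination h4 + mul_le_mul_of_nonneg_left h2 h3.le
  · push Not at h
    rw [norm_neg] at hnorm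
    have h1 : dot (dir S) (sinhVec S) = sinh ‖S‖ := by
      rw [sinhVec, dot_mul_ofReal, dot_self, hnorm, one_pow, mul_one]
    have h2 := dot_sinhVec_le T hnorm
    have h3 : 0 < sinh ρ + sinh ‖S‖ := by
      have := sinh_nonneg_iff.2 (norm_nonneg S)
      have := sinh_lt_sinh.2 hS
      linarith
    rw [bisectorForm, dot_sub, dot_neg_left, dot_neg_left, h1]
    rcases h.eq_or_lt with heq | hlt
    · rw [heq] at h2 ⊢
      have h4 : dot (dir S) (sinhVec T) ≠ sinh ‖S‖ := by
        intro h5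
        apply hST
        apply sinhVec_injective
        have h6 : dot (sinhVec T - sinhVec S) (sinhVec T - sinhVec S) = 0 := by
          have e1 := dot_self (sinhVec T)
          have e2 := dot_self (sinhVec S)
          have e3 : dot (sinhVec S) (sinhVec T) = sinh ‖S‖ * sinh ‖S‖ := by
            nth_rewrite 1 [sinhVec]
            rw [dot_ofReal_mul, h5]
          rw [norm_sinhVec] at e1 e2
          rw [heq] at e1
          rw [dot_sub, dot_comm _ (sinhVec T), dot_comm _ (sinhVec S), dot_sub, dot_sub,
            dot_comm (sinhVec T) (sinhVec S)]
          linarith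
        rw [dot_self] at h6
        exact sub_eq_zero.1 (norm_eq_zero.1 (pow_eq_zero_iff (by norm_num) |>.1 h6))
      have h5 := mul_pos hb (sub_pos.2 (lt_of_le_of_ne h2 h4))
      linarith
    · have h4 := cosh_sub_cosh_pos (norm_nonneg T) hlt
      have h5 := mul_pos h3 h4
      have h6 := mul_nonneg hb.le (by linarith [sinh_lt_sinh.2 hlt] :
        0 ≤ sinh ‖S‖ - dot (dir S) (sinhVec T))
      linarith

theorem bisectorForm_dir_nonpos {𝒮 : Finset ℂ} {S T P : ℂ} {ρ : ℝ} (hS : ‖S‖ < ρ)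
    (hP : P ∈ activePart 𝒮 S ρ) (hT : T ∈ 𝒮) : bisectorForm S T ρ (dir P) ≤ 0 := by
  have h0 := norm_dir (ne_zero_of_mem_beachEllipse hS hP.1)
  rw [bisectorForm_nonpos_iff hS h0, ← eq_ellipsePoint hS hP.1]
  exact coshDist_le_of_mem_activePart hS hP hT

theorem ellipsePoint_mem_activePart {𝒮 : Finset ℂ} {S e : ℂ} {ρ : ℝ} (hS : ‖S‖ < ρ)
    (hρ : ∀ T ∈ 𝒮, ‖T‖ ≠ ρ) (he : ‖e‖ = 1)
    (h : ∀ T ∈ 𝒮, T ≠ S → ‖T‖ < ρ → bisectorForm S T ρ e ≤ 0) :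
    ellipsePoint S ρ e ∈ activePart 𝒮 S ρ := by
  have hmem := ellipsePoint_mem hS he
  refine mem_activePart_of_closest hS hmem fun T hT => ?_
  rcases eq_or_ne T S with rfl | hTS
  · exact Or.inr ⟨le_rfl, hS⟩
  rcases (hρ T hT).lt_or_gt with hlt | hgt
  · exact Or.inr ⟨(bisectorForm_nonpos_iff hS he).1 (h T hT hTS hlt), hlt⟩
  · left
    obtain ⟨h1, h2⟩ := mem_beachEllipse_iff.1 hmem
    rw [h2]
    refine lt_of_lt_of_le ?_ (cosh_norm_sub_le_coshDist _ T)
    rw [cosh_lt_cosh, abs_of_nonneg (by linarith), abs_of_nonpos (by linarith)]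
    linarith

theorem connectedComponentIn_eq_of_isPreconnected {A N : Set ℂ} (hN : IsPreconnected N)
    (hNA : N ⊆ A) {P Q : ℂ} (hP : P ∈ N) (hQ : Q ∈ N) :
    connectedComponentIn A P = connectedComponentIn A Q :=
  connectedComponentIn_eq (hN.subset_connectedComponentIn hP hNA hQ)

theorem activeSegments.eq_connectedComponentIn {𝒮 : Finset ℂ} {S P : ℂ} {ρ : ℝ} {C : Set ℂ}
    (hC : C ∈ activeSegments 𝒮 S ρ) (hP : P ∈ C) :
    C = connectedComponentIn (activePart 𝒮 S ρ) P := by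
  obtain ⟨-, Q, -, rfl⟩ := hC
  exact connectedComponentIn_eq hP

theorem activeSegments.subset {𝒮 : Finset ℂ} {S : ℂ} {ρ : ℝ} {C : Set ℂ}
    (hC : C ∈ activeSegments 𝒮 S ρ) : C ⊆ activePart 𝒮 S ρ := by
  obtain ⟨-, Q, -, rfl⟩ := hC
  exact connectedComponentIn_subset _ _

/-- Without site events no segment splits. -/
theorem Continues.unique {𝒮 : Finset ℂ} {S : ℂ} {r₁ r₂ : ℝ} (hS : ‖S‖ < r₁) (hr : r₁ ≤ r₂)
    (hsites : ∀ T ∈ 𝒮, ‖T‖ < r₁ ∨ r₂ < ‖T‖) {C' C D : Set ℂ} (hC' : C' ∈ activeSegments 𝒮 S r₁)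
    (hC : C ∈ activeSegments 𝒮 S r₂) (hD : D ∈ activeSegments 𝒮 S r₂)
    (hCC : Continues 𝒮 S r₁ C' r₂ C) (hCD : Continues 𝒮 S r₁ C' r₂ D) : D = C := by
  obtain ⟨γ, hγc, hγ, hγ₁, hγ₂⟩ := hCC
  obtain ⟨δ, hδc, hδ, hδ₁, hδ₂⟩ := hCD
  have h₁ : r₁ ∈ Icc r₁ r₂ := ⟨le_rfl, hr⟩
  have h₂ : r₂ ∈ Icc r₁ r₂ := ⟨hr, le_rfl⟩
  have hS₂ := hS.trans_le hr
  have hact : ∀ γ : ℝ → ℂ, (∀ ρ ∈ Icc r₁ r₂, ∃ D ∈ activeSegments 𝒮 S ρ, γ ρ ∈ D) →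
      ∀ ρ ∈ Icc r₁ r₂, γ ρ ∈ activePart 𝒮 S ρ := by
    intro γ hγ ρ hρ
    obtain ⟨D, hD, hmem⟩ := hγ ρ hρ
    exact activeSegments.subset hD hmem
  have hne : ∀ ρ ∈ Icc r₁ r₂, ∀ P ∈ activePart 𝒮 S ρ, P ≠ 0 := fun ρ hρ P hP =>
    ne_zero_of_mem_beachEllipse (hS.trans_le hρ.1) hP.1
  -- Both paths start in the connected segment `C'`, so `M` is connected. Its points come from
  -- different sweep radii, which is why the barriers must not depend on the radius.
  let M : Set ℂ := dir '' (γ '' Icc r₁ r₂ ∪ C' ∪ δ '' Icc r₁ r₂)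
  have hM_act : ∀ P ∈ γ '' Icc r₁ r₂ ∪ C' ∪ δ '' Icc r₁ r₂,
      ∃ ρ ∈ Icc r₁ r₂, P ∈ activePart 𝒮 S ρ := by
    rintro P ((⟨ρ, hρ, rfl⟩ | hP) | ⟨ρ, hρ, rfl⟩)
    · exact ⟨ρ, hρ, hact γ hγ ρ hρ⟩
    · exact ⟨r₁, h₁, activeSegments.subset hC' hP⟩
    · exact ⟨ρ, hρ, hact δ hδ ρ hρ⟩
  have hC'pre : IsPreconnected C' := by
    obtain ⟨-, Q, -, rfl⟩ := hC'
    exact isPreconnected_connectedComponentIn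
  have hM : IsPreconnected M := by
    refine IsPreconnected.image ?_ _ fun P hP => ?_
    · refine IsPreconnected.union (δ r₁) (Or.inr hδ₁) ⟨r₁, h₁, rfl⟩ ?_
        (isPreconnected_Icc.image _ hδc)
      exact IsPreconnected.union (γ r₁) ⟨r₁, h₁, rfl⟩ hγ₁ (isPreconnected_Icc.image _ hγc) hC'pre
    · obtain ⟨ρ, hρ, hPact⟩ := hM_act P hP
      exact (continuousAt_dir (hne ρ hρ P hPact)).continuousWithinAt
  have hM1 : ∀ x ∈ M, ‖x‖ = 1 := by
    rintro _ ⟨P, hP, rfl⟩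
    obtain ⟨ρ, hρ, hPact⟩ := hM_act P hP
    exact norm_dir (hne ρ hρ P hPact)
  -- By `hsites` all remaining sites other than `S` lie beyond `r₂` and cannot deactivate a point.
  let J : Set ℂ := {T | T ∈ 𝒮 ∧ T ≠ S ∧ ‖T‖ < r₁}
  have hMw : ∀ T ∈ J, barrier S T ∉ M := by
    rintro T ⟨hT, hTS, hTr⟩ ⟨P, hP, heq⟩
    obtain ⟨ρ, hρ, hPact⟩ := hM_act P hP
    have h1 := bisectorForm_dir_nonpos (hS.trans_le hρ.1) hPact hT
    rw [heq] at h1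
    exact h1.not_gt (bisectorForm_barrier_pos hTS (hS.trans_le hρ.1) (hTr.trans_le hρ.1))
  have hγact := hact γ hγ r₂ h₂
  have hδact := hact δ hδ r₂ h₂
  have hform := fun T e => bisectorForm_eq S T r₂ e
  obtain ⟨N, hN, heN, hfN, hNJ⟩ := exists_isPreconnected_nonpos (J := J)
    (a := fun T => sinh r₂ * (cosh ‖S‖ - cosh ‖T‖))
    (b := fun T => ((cosh r₂ - cosh ‖S‖ : ℝ) : ℂ) * sinhVec T
        - ((cosh r₂ - cosh ‖T‖ : ℝ) : ℂ) * sinhVec S) (w := barrier S)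
    (fun T hT => norm_barrier hT.2.1)
    (fun T hT => by
      rw [← hform]; exact bisectorForm_barrier_pos hT.2.1 hS₂ (hT.2.2.trans_le hr))
    hM hM1 hMw (e := dir (γ r₂)) (f := dir (δ r₂))
    ⟨_, Or.inl (Or.inl ⟨r₂, h₂, rfl⟩), rfl⟩ ⟨_, Or.inr ⟨r₂, h₂, rfl⟩, rfl⟩
    (fun T hT => by rw [← hform]; exact bisectorForm_dir_nonpos hS₂ hγact hT.1)
    (fun T hT => by rw [← hform]; exact bisectorForm_dir_nonpos hS₂ hδact hT.1)
  rw [activeSegments.eq_connectedComponentIn hC hγ₂, activeSegments.eq_connectedComponentIn hD hδ₂]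
  refine connectedComponentIn_eq_of_isPreconnected (N := ellipsePoint S r₂ '' N) ?_ ?_
    ⟨_, hfN, (eq_ellipsePoint hS₂ hδact.1).symm⟩ ⟨_, heN, (eq_ellipsePoint hS₂ hγact.1).symm⟩
  · refine hN.image _ fun x hx => ContinuousAt.continuousWithinAt ?_
    exact ContinuousAt.comp (f := fun x => (r₂, x)) (g := fun x : ℝ × ℂ => ellipsePoint S x.1 x.2)
      (continuousAt_ellipsePoint hS₂ (hNJ x hx).1) (by fun_prop)
  · rintro _ ⟨x, hx, rfl⟩
    refine ellipsePoint_mem_activePart hS₂ (fun T hT heq => ?_) (hNJ x hx).1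
      fun T hT hTS hTr => ?_
    · rcases hsites T hT with h | h <;> linarith
    · rw [hform]
      refine (hNJ x hx).2 T ⟨hT, hTS, ?_⟩
      rcases hsites T hT with h | h
      · exact h
      · linarith

theorem norm_le_of_mem_activeSegments {𝒮 : Finset ℂ} {S : ℂ} {ρ : ℝ} {C : Set ℂ}
    (hC : C ∈ activeSegments 𝒮 S ρ) : ‖S‖ ≤ ρ := by
  obtain ⟨P, hP⟩ := hC.1.nonempty
  exact norm_le_of_mem_beachEllipse (activeSegments.subset hC hP).1

theorem BecameActive.exists_site {𝒮 : Finset ℂ} {S : ℂ} (hS : S ∈ 𝒮) {r₁ r₂ : ℝ} (hr : r₁ < r₂)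
    {C : Set ℂ} (h : BecameActive 𝒮 S r₁ r₂ C) : ∃ T ∈ 𝒮, r₁ ≤ ‖T‖ ∧ ‖T‖ ≤ r₂ := by
  by_contra! hno
  obtain ⟨hC, h⟩ := h
  have hsites : ∀ T ∈ 𝒮, ‖T‖ < r₁ ∨ r₂ < ‖T‖ := fun T hT =>
    (lt_or_ge ‖T‖ r₁).imp_right (hno T hT)
  have hS₁ : ‖S‖ < r₁ :=
    (hsites S hS).resolve_right (norm_le_of_mem_activeSegments hC).not_gt
  obtain ⟨C', hC', hcont⟩ := exists_continues hS₁ hr.le hC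
  exact h ⟨C', hC', hcont, fun D hD hCD => hcont.unique hS₁ hr.le hsites hC' hC hD hCD⟩

/-! ### Intersections that enter the beach curve -/

/-- The far point of a circle with center `V ≠ 0` and radius `d` has radius `‖V‖ + d`. -/
theorem exists_isFarPoint {V : ℂ} (hV : V ≠ 0) {d : ℝ} (hd : 0 ≤ d) :
    ∃ V', IsFarPoint V d V' ∧ ‖V'‖ = ‖V‖ + d := by
  have he := norm_dir hV
  have hn : ‖((‖V‖ + d : ℝ) : ℂ) * dir V‖ = ‖V‖ + d := norm_ofReal_mul (by positivity) he
  refine ⟨((‖V‖ + d : ℝ) : ℂ) * dir V, ⟨?_, fun Q hQ => ?_⟩, hn⟩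
  · refine (hypDist_eq_iff hd).2 ?_
    rw [coshDist, hn, sinhVec_ofReal_mul (by positivity) he, sinhVec, dot_ofReal_mul,
      dot_mul_ofReal, dot_self, he]
    have : cosh d = cosh ((‖V‖ + d) - ‖V‖) := by congr 1; ring
    rw [this, cosh_sub]; ring
  · have h1 := (hypDist_eq_iff hd).1 hQ
    have h2 := cosh_norm_sub_le_coshDist V Q
    rw [h1, cosh_le_cosh, abs_of_nonneg hd] at h2
    rw [hn]
    linarith [neg_abs_le (‖V‖ - ‖Q‖)]

/-- An intersection enters the beach curve only at an event. -/
theorem IntersectionEntersAt.mem_eventRadii {𝒮 : Finset ℂ} {S T : ℂ} (hS : S ∈ 𝒮) (hT : T ∈ 𝒮)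
    (hST : S ≠ T) {r : ℝ} (h : IntersectionEntersAt 𝒮 S T r) : (r : EReal) ∈ eventRadii 𝒮 := by
  by_contra hev
  obtain ⟨ε, hε, I, hI, hmem, hout, hin⟩ := h
  have hsite : ∀ U ∈ 𝒮, ‖U‖ ≠ r := fun U hU heq => hev (Or.inl (Or.inr ⟨U, hU, by rw [heq]⟩))
  have hl : r - ε ∈ Icc (r - ε) r := ⟨le_rfl, by linarith⟩
  have hrm : r ∈ Icc (r - ε) r := ⟨by linarith, le_rfl⟩
  have hSr : ‖S‖ ≤ r - ε := norm_le_of_mem_beachEllipse (hmem _ hl).1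
  have hTr : ‖T‖ ≤ r - ε := norm_le_of_mem_beachEllipse (hmem _ hl).2
  obtain ⟨U, ⟨hU, hUr⟩, hIU⟩ : ∃ U ∈ seenSites 𝒮 r, I r ∈ activePart 𝒮 U r := by
    simpa [beachCurve] using hin
  have hUr : ‖U‖ < r := lt_of_le_of_ne hUr (hsite U hU)
  obtain ⟨h1, h2⟩ := mem_beachEllipse_iff.1 (hmem r hrm).1
  have h3 := (mem_beachEllipse_iff.1 (hmem r hrm).2).2
  have hmin : ∀ W ∈ 𝒮, cosh (r - ‖I r‖) ≤ coshDist (I r) W := by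
    intro W hW
    rw [← (mem_beachEllipse_iff.1 hIU.1).2]
    exact coshDist_le_of_mem_activePart hUr hIU hW
  have hI0 : I r ≠ 0 := ne_zero_of_mem_beachEllipse hUr hIU.1
  have hd : 0 ≤ r - ‖I r‖ := by linarith
  -- A third site at the same distance would make `I r` a Voronoi vertex with far radius `‖I r‖ + (r
  -- - ‖I r‖) = r`.
  have hstrict : ∀ W ∈ 𝒮, W ≠ S → W ≠ T → coshDist (I r) S < coshDist (I r) W := by
    intro W hW hWS hWT
    rw [h2]
    refine lt_of_le_of_ne (hmin W hW) fun heq => hev ?_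
    obtain ⟨V', hV', hV'n⟩ := exists_isFarPoint hI0 hd
    refine Or.inr ⟨I r, r - ‖I r‖, V', ⟨fun W hW => (le_hypDist_iff hd).2 (hmin W hW), ?_⟩, hV', ?_⟩
    · have hcard : ({S, T, W} : Finset ℂ).card = 3 :=
        Finset.card_eq_three.2 ⟨S, T, W, hST, hWS.symm, hWT.symm, rfl⟩
      rw [← hcard, ← Set.ncard_coe_finset]
      refine Set.ncard_le_ncard ?_ (𝒮.finite_toSet.subset fun x hx => hx.1)
      intro x hx
      simp only [Finset.coe_insert, Finset.coe_singleton, mem_insert_iff, mem_singleton_iff] at hx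
      rcases hx with rfl | rfl | rfl
      · exact ⟨hS, (hypDist_eq_iff hd).2 h2⟩
      · exact ⟨hT, (hypDist_eq_iff hd).2 h3⟩
      · exact ⟨hW, (hypDist_eq_iff hd).2 heq.symm⟩
    · rw [hV'n]
      congr 1
      ring
  have hcd : ∀ W, Filter.Tendsto (fun ρ => coshDist (I ρ) W) (nhdsWithin r (Ico (r - ε) r))
      (nhds (coshDist (I r) W)) := fun W =>
    (ContinuousAt.comp_continuousWithinAt (g := fun z => coshDist z W) (f := I)
      (continuousAt_coshDist hI0 W) (hI r hrm)).mono Ico_subset_Icc_self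
  have hnear : ∀ᶠ ρ in nhdsWithin r (Ico (r - ε) r),
      ∀ W ∈ 𝒮, W ≠ S → W ≠ T → coshDist (I ρ) S < coshDist (I ρ) W := by
    simp only [Finset.eventually_all, Filter.eventually_imp_distrib_left]
    intro W hW hWS hWT
    exact (hcd S).eventually_lt (hcd W) (hstrict W hW hWS hWT)
  -- Leaving out the left end point makes `‖S‖` and `‖T‖` strictly smaller than `ρ`, so neither
  -- ellipse is degenerate.
  have hgt : ∀ᶠ ρ in nhdsWithin r (Ico (r - ε) r), r - ε < ρ :=
    (eventually_gt_nhds (by linarith)).filter_mono nhdsWithin_le_nhds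
  have hbot : (nhdsWithin r (Ico (r - ε) r)).NeBot := by
    rw [← mem_closure_iff_nhdsWithin_neBot, closure_Ico (by linarith)]
    exact hrm
  obtain ⟨ρ, hclose, hgtρ, hρ⟩ := (hnear.and (hgt.and self_mem_nhdsWithin)).exists
  have hρ' := Ico_subset_Icc_self hρ
  refine hout ρ hρ (mem_biUnion (show S ∈ seenSites 𝒮 ρ from ⟨hS, by linarith⟩) ?_)
  refine mem_activePart_of_closest (by linarith) (hmem ρ hρ').1 fun W hW => ?_
  rcases eq_or_ne W S with rfl | hWS
  · exact Or.inr ⟨le_rfl, by linarith⟩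
  rcases eq_or_ne W T with rfl | hWT
  · refine Or.inr ⟨?_, by linarith⟩
    rw [(mem_beachEllipse_iff.1 (hmem ρ hρ').1).2, (mem_beachEllipse_iff.1 (hmem ρ hρ').2).2]
  · exact Or.inl (hclose W hW hWS hWT)

end HyperbolicSweep

end

theorem mainTheorem3 (𝒮 : Finset ℂ) :
    -- a segment becomes active only through a site event
    (∀ S ∈ 𝒮, ∀ r₁ r₂ : ℝ, r₁ < r₂ → ∀ C : Set ℂ, BecameActive 𝒮 S r₁ r₂ C →
      ∃ T ∈ 𝒮, r₁ ≤ ‖T‖ ∧ ‖T‖ ≤ r₂) ∧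
    -- if it is not even a part of an earlier segment, then the event is that of its own site
    (∀ S ∈ 𝒮, ∀ r₁ r₂ : ℝ, r₁ < r₂ → ∀ C ∈ activeSegments 𝒮 S r₂,
      (¬ ∃ C' ∈ activeSegments 𝒮 S r₁, Continues 𝒮 S r₁ C' r₂ C) →
      r₁ ≤ ‖S‖ ∧ ‖S‖ ≤ r₂) ∧
    -- no intersection enters the beach curve between consecutive events
    (∀ rᵢ ∈ eventRadii 𝒮, ∀ rⱼ ∈ eventRadii 𝒮,
      (∀ q ∈ eventRadii 𝒮, ¬ (rᵢ < q ∧ q < rⱼ)) →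
      ∀ r : ℝ, rᵢ < (r : EReal) → (r : EReal) < rⱼ →
      ∀ S ∈ 𝒮, ∀ T ∈ 𝒮, S ≠ T → ¬ IntersectionEntersAt 𝒮 S T r) := by
  refine ⟨fun S hS r₁ r₂ hr C h => h.exists_site hS hr, fun S _ r₁ r₂ hr C hC h => ⟨?_, ?_⟩,
    fun rᵢ _ rⱼ _ hcons r hi hj S hS T hT hST h => hcons r (h.mem_eventRadii hS hT hST) ⟨hi, hj⟩⟩
  · by_contra! hS
    exact h (exists_continues hS hr.le hC)
  · exact norm_le_of_mem_activeSegments hC
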